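/- Conventions. $G$ is a locally compact Hausdorff étale groupoid with unit space $G^{(0)}$ and range and source maps $r,s$ (étale: $r$ is a local homeomorphism), and $G^{(0)}\times\mathbb T\xrightarrow{\iota}\Sigma\xrightarrow{q}G$ is a twist over $G$, that is, a locally trivial central extension of $G$ by $\mathbb T$ with $\Sigma$ a locally compact Hausdorff groupoid whose unit space is identified with $G^{(0)}$. $C_c(\Sigma;G)$ is the space of continuous compactly supported $f:\Sigma\to\mathbb C$ with $f(z\sigma)=zf(\sigma)$ for $z\in\mathbb T$, and $C^*_r(\Sigma;G)$ is its completion in the reduced norm, i.e. the $C^*$-algebra generated by the left convolution operators $f*\cdot$, $f\in C_c(\Sigma;G)$, on $\bigoplus_{x\in G^{(0)}}L^2(\Sigma_x;G_x)$. A set $\Delta\subseteq G^{(0)}$ is invariant if $s(\gamma)\in\Delta$ implies $r(\gamma)\in\Delta$; then $G_\Delta=\{\gamma: r(\gamma),s(\gamma)\in\Delta\}$ and $\Sigma_\Delta=q^{-1}(G_\Delta)$. For an invariant open $U\subseteq G^{(0)}$ with complement $F$, extension of functions by zero induces an embedding $C^*_r(\Sigma_U;G_U)\to C^*_r(\Sigma;G)$,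 by which we regard $C^*_r(\Sigma_U;G_U)$ as a subalgebra of $C^*_r(\Sigma;G)$, and restriction of functions induces a $*$-homomorphism $\phi_F:C^*_r(\Sigma;G)\to C^*_r(\Sigma_F;G_F)$. $G$ is called exact (inner exact) if $C^*_r(\Sigma_U;G_U)\to C^*_r(\Sigma;G)\xrightarrow{\phi_F}C^*_r(\Sigma_F;G_F)$ is exact in the middle, i.e. $\ker\phi_F=C^*_r(\Sigma_U;G_U)$, for every invariant open $U$. Likewise $C_0(G^{(0)})$ is regarded as a subalgebra of $C^*_r(\Sigma;G)$. For a subset $S$ of a $C^*$-algebra $A$ put $S^\perp=\{a\in A: as=sa=0\text{ for all }s\in S\}$. A closed two-sided ideal $J$ of $A$ is regular if $J=J^{\perp\perp}$. A subalgebra $B\subseteq A$ has the regular ideal intersection property in $A$ if $J\cap B\neq\{0\}$ for every nonzero regular ideal $J$ of $A$. An open set is regular if it is the interior of its closure. Theorem. Let $\Sigma\to G$ be a twist over a locally compact Hausdorff étale groupoid, and suppose that $G$ is exact. 1. If $U\subseteq G^{(0)}$ is a regular invariant open set, then $C^*_r(\Sigma_U;G_U)$ is a regular ideal of $C^*_r(\Sigma;G)$.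 2. If, in addition, $C_0(G^{(0)})$ has the regular ideal intersection property in $C^*_r(\Sigma;G)$, then every regular ideal of $C^*_r(\Sigma;G)$ is of the form $C^*_r(\Sigma_U;G_U)$ for some regular invariant open set $U\subseteq G^{(0)}$. -/

import Mathlib

open Topology

/-- A topological groupoid with unit space `X` and arrow space `G`. -/
structure TopGroupoid (X G : Type*) [TopologicalSpace X] [TopologicalSpace G] where
  r : G → X
  s : G → X
  unit : X → G
  mul : (g h : G) → s g = r h → G
  inv : G → G
  r_unit : ∀ x, r (unit x) = x
  s_unit : ∀ x, s (unit x) = x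
  r_mul : ∀ g h H, r (mul g h H) = r g
  s_mul : ∀ g h H, s (mul g h H) = s h
  r_inv : ∀ g, r (inv g) = s g
  s_inv : ∀ g, s (inv g) = r g
  mul_assoc : ∀ (g h k : G) (H₁ : s g = r h) (H₂ : s h = r k),
    mul (mul g h H₁) k ((s_mul g h H₁).trans H₂) =
      mul g (mul h k H₂) (H₁.trans (r_mul h k H₂).symm)
  unit_mul : ∀ g, mul (unit (r g)) g (s_unit (r g)) = g
  mul_unit : ∀ g, mul g (unit (s g)) (r_unit (s g)).symm = g
  mul_inv : ∀ g, mul g (inv g) (r_inv g).symm = unit (r g)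
  inv_mul : ∀ g, mul (inv g) g (s_inv g) = unit (s g)
  continuous_r : Continuous r
  continuous_s : Continuous s
  continuous_unit : Continuous unit
  continuous_inv : Continuous inv
  continuous_mul : Continuous fun p : {p : G × G // s p.1 = r p.2} => mul p.1.1 p.1.2 p.2

/-- An étale groupoid: the range map (hence also the source map) is a local homeomorphism. -/
structure EtaleGroupoid (X G : Type*) [TopologicalSpace X] [TopologicalSpace G]
    extends TopGroupoid X G where
  isLocalHomeomorph_r : IsLocalHomeomorph r

namespace TopGroupoid

variable {X G : Type*} [TopologicalSpace X] [TopologicalSpace G] (𝒢 : TopGroupoid X G)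

/-- `G_Δ`, the arrows with range and source in `Δ`. -/
def reduction (Δ : Set X) : Set G := {γ | 𝒢.r γ ∈ Δ ∧ 𝒢.s γ ∈ Δ}

/-- A set of units is invariant if `s γ ∈ Δ` implies `r γ ∈ Δ`. -/
def Invariant (Δ : Set X) : Prop := ∀ γ, 𝒢.s γ ∈ Δ → 𝒢.r γ ∈ Δ

variable {𝒢}

theorem mul_congr {g g' h h' : G} (hg : g = g') (hh : h = h') (H : 𝒢.s g = 𝒢.r h) :
    𝒢.mul g h H = 𝒢.mul g' h' (hg ▸ hh ▸ H) := by
  subst hg hh; rfl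

theorem mul_inv_cancel (g h : G) (H : 𝒢.s g = 𝒢.r h) :
    𝒢.mul (𝒢.mul g h H) (𝒢.inv h) ((𝒢.s_mul g h H).trans (𝒢.r_inv h).symm) = g := by
  rw [𝒢.mul_assoc g h (𝒢.inv h) H (𝒢.r_inv h).symm, mul_congr rfl (𝒢.mul_inv h)]
  have := 𝒢.mul_unit g
  rw [mul_congr rfl (congrArg 𝒢.unit H)] at this
  exact this

theorem inv_mul_cancel (g h : G) (H : 𝒢.s g = 𝒢.r h) :
    𝒢.mul (𝒢.inv g) (𝒢.mul g h H) ((𝒢.s_inv g).trans (𝒢.r_mul g h H).symm) = h := by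
  rw [← 𝒢.mul_assoc (𝒢.inv g) g h (𝒢.s_inv g) H, mul_congr (𝒢.inv_mul g) rfl]
  have := 𝒢.unit_mul h
  rw [mul_congr (congrArg 𝒢.unit H.symm) rfl] at this
  exact this

theorem mul_right_cancel {g g' h : G} {H : 𝒢.s g = 𝒢.r h} {H' : 𝒢.s g' = 𝒢.r h}
    (e : 𝒢.mul g h H = 𝒢.mul g' h H') : g = g' := by
  rw [← mul_inv_cancel g h H, ← mul_inv_cancel g' h H']
  exact mul_congr e rfl _

theorem mul_left_cancel {g h h' : G} {H : 𝒢.s g = 𝒢.r h} {H' : 𝒢.s g = 𝒢.r h'}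
    (e : 𝒢.mul g h H = 𝒢.mul g h' H') : h = h' := by
  rw [← inv_mul_cancel g h H, ← inv_mul_cancel g h' H']
  exact mul_congr rfl e _

theorem inv_inv (g : G) : 𝒢.inv (𝒢.inv g) = g := by
  apply mul_left_cancel (g := 𝒢.inv g) (H := (𝒢.r_inv _).symm) (H' := 𝒢.s_inv g)
  rw [𝒢.mul_inv, 𝒢.inv_mul, 𝒢.r_inv]

theorem inv_injective : Function.Injective 𝒢.inv := fun g h e => by
  rw [← inv_inv (𝒢 := 𝒢) g, e, inv_inv]

theorem inv_eq_of_mul_eq_unit {g h : G} (H : 𝒢.s g = 𝒢.r h) (e : 𝒢.mul g h H = 𝒢.unit (𝒢.r g)) :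
    𝒢.inv g = h := by
  apply mul_left_cancel (g := g) (H := (𝒢.r_inv _).symm) (H' := H)
  rw [𝒢.mul_inv, e]

theorem Invariant.range_mem_iff {Δ : Set X} (hΔ : 𝒢.Invariant Δ) (γ : G) :
    𝒢.r γ ∈ Δ ↔ 𝒢.s γ ∈ Δ :=
  ⟨fun h => by simpa [𝒢.r_inv] using hΔ (𝒢.inv γ) (by rwa [𝒢.s_inv]), hΔ γ⟩

theorem Invariant.mem_reduction_iff {Δ : Set X} (hΔ : 𝒢.Invariant Δ) (γ : G) :
    γ ∈ 𝒢.reduction Δ ↔ 𝒢.s γ ∈ Δ :=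
  ⟨fun h => h.2, fun h => ⟨hΔ γ h, h⟩⟩

theorem Invariant.compl {Δ : Set X} (hΔ : 𝒢.Invariant Δ) : 𝒢.Invariant Δᶜ :=
  fun γ h h' => h ((hΔ.range_mem_iff γ).1 h')

variable (𝒢)

/-- The groupoid `G_Δ` with unit space `Δ`, in the subspace topologies. -/
def restrict (Δ : Set X) : TopGroupoid Δ (𝒢.reduction Δ) where
  r γ := ⟨𝒢.r γ, γ.2.1⟩
  s γ := ⟨𝒢.s γ, γ.2.2⟩
  unit x := ⟨𝒢.unit x, ⟨(𝒢.r_unit x).symm ▸ x.2, (𝒢.s_unit x).symm ▸ x.2⟩⟩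
  mul g h H := ⟨𝒢.mul g h (congrArg Subtype.val H),
    ⟨(𝒢.r_mul g h (congrArg Subtype.val H)).symm ▸ g.2.1,
      (𝒢.s_mul g h (congrArg Subtype.val H)).symm ▸ h.2.2⟩⟩
  inv g := ⟨𝒢.inv g, ⟨(𝒢.r_inv g).symm ▸ g.2.2, (𝒢.s_inv g).symm ▸ g.2.1⟩⟩
  r_unit x := Subtype.ext (𝒢.r_unit x)
  s_unit x := Subtype.ext (𝒢.s_unit x)
  r_mul g h _ := Subtype.ext (𝒢.r_mul g h _)
  s_mul g h _ := Subtype.ext (𝒢.s_mul g h _)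
  r_inv g := Subtype.ext (𝒢.r_inv g)
  s_inv g := Subtype.ext (𝒢.s_inv g)
  mul_assoc g h k _ _ := Subtype.ext (𝒢.mul_assoc g h k _ _)
  unit_mul g := Subtype.ext (𝒢.unit_mul g)
  mul_unit g := Subtype.ext (𝒢.mul_unit g)
  mul_inv g := Subtype.ext (𝒢.mul_inv g)
  inv_mul g := Subtype.ext (𝒢.inv_mul g)
  continuous_r := (𝒢.continuous_r.comp continuous_subtype_val).subtype_mk _
  continuous_s := (𝒢.continuous_s.comp continuous_subtype_val).subtype_mk _
  continuous_unit := (𝒢.continuous_unit.comp continuous_subtype_val).subtype_mk _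
  continuous_inv := (𝒢.continuous_inv.comp continuous_subtype_val).subtype_mk _
  continuous_mul := by
    refine Continuous.subtype_mk (𝒢.continuous_mul.comp (Continuous.subtype_mk
      (f := fun p : {p : 𝒢.reduction Δ × 𝒢.reduction Δ //
        (⟨𝒢.s p.1, p.1.2.2⟩ : Δ) = ⟨𝒢.r p.2, p.2.2.1⟩} => ((p.1.1 : G), (p.1.2 : G)))
      ?_ fun p => congrArg Subtype.val p.2)) _
    fun_prop

end TopGroupoid

namespace EtaleGroupoid

variable {X G : Type*} [TopologicalSpace X] [TopologicalSpace G] (𝒢 : EtaleGroupoid X G)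

theorem isLocalHomeomorph_s : IsLocalHomeomorph 𝒢.s := by
  let e : G ≃ₜ G :=
    { toFun := 𝒢.inv, invFun := 𝒢.inv
      left_inv := fun g => TopGroupoid.inv_inv g, right_inv := fun g => TopGroupoid.inv_inv g
      continuous_toFun := 𝒢.continuous_inv, continuous_invFun := 𝒢.continuous_inv }
  have : 𝒢.s = 𝒢.r ∘ e := funext fun g => (𝒢.r_inv g).symm
  rw [this]
  exact 𝒢.isLocalHomeomorph_r.comp e.isLocalHomeomorph

/-- The étale groupoid `G_Δ` for an invariant set `Δ` of units. -/
def restrict (Δ : Set X) (hΔ : 𝒢.Invariant Δ) : EtaleGroupoid Δ (𝒢.reduction Δ) where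
  toTopGroupoid := 𝒢.toTopGroupoid.restrict Δ
  isLocalHomeomorph_r := by
    rw [isLocalHomeomorph_iff_isOpenEmbedding_restrict]
    rintro ⟨γ, hγ⟩
    obtain ⟨U, hU, hemb⟩ := isLocalHomeomorph_iff_isOpenEmbedding_restrict.1
      𝒢.isLocalHomeomorph_r γ
    refine ⟨Subtype.val ⁻¹' U, continuous_subtype_val.continuousAt hU, ?_⟩
    have hres := Δ.restrictPreimage_isOpenEmbedding hemb
    let e : (Subtype.val ⁻¹' U : Set (𝒢.reduction Δ)) ≃ₜ (U.domRestrict 𝒢.r ⁻¹' Δ) :=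
      { toFun := fun g => ⟨⟨g.1.1, g.2⟩, g.1.2.1⟩
        invFun := fun g => ⟨⟨g.1.1, g.2, (hΔ.range_mem_iff _).1 g.2⟩, g.1.2⟩
        left_inv := fun g => rfl
        right_inv := fun g => rfl
        continuous_toFun := by fun_prop
        continuous_invFun := by fun_prop }
    exact hres.comp e.isOpenEmbedding

end EtaleGroupoid

/-- A twist `X × 𝕋 → Σ → G` over an étale groupoid `G` with unit space `X`: a locally trivial
central extension of groupoids. The unit space of `E = Σ` is identified with `X`. -/
structure Twist {X G : Type*} [TopologicalSpace X] [TopologicalSpace G] (𝒢 : EtaleGroupoid X G)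
    (E : Type*) [TopologicalSpace E] where
  grpd : TopGroupoid X E
  ι : X → Circle → E
  q : E → G
  r_ι : ∀ x z, grpd.r (ι x z) = x
  s_ι : ∀ x z, grpd.s (ι x z) = x
  ι_one : ∀ x, ι x 1 = grpd.unit x
  ι_mul : ∀ x z w, grpd.mul (ι x z) (ι x w) ((s_ι x z).trans (r_ι x w).symm) = ι x (z * w)
  isEmbedding_ι : IsEmbedding fun p : X × Circle => ι p.1 p.2
  r_q : ∀ σ, 𝒢.r (q σ) = grpd.r σ
  s_q : ∀ σ, 𝒢.s (q σ) = grpd.s σ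
  q_unit : ∀ x, q (grpd.unit x) = 𝒢.unit x
  q_mul : ∀ σ τ (H : grpd.s σ = grpd.r τ),
    q (grpd.mul σ τ H) = 𝒢.mul (q σ) (q τ) ((s_q σ).trans (H.trans (r_q τ).symm))
  continuous_q : Continuous q
  surjective_q : Function.Surjective q
  q_eq_unit_iff : ∀ σ x, q σ = 𝒢.unit x ↔ ∃ z, ι x z = σ
  central : ∀ σ z, grpd.mul (ι (grpd.r σ) z) σ (s_ι _ z) = grpd.mul σ (ι (grpd.s σ) z) (r_ι _ z).symm
  exists_local_section : ∀ γ : G, ∃ B : Set G, IsOpen B ∧ γ ∈ B ∧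
    ∃ S : B → E, Continuous S ∧ ∀ b, q (S b) = b

namespace Twist

variable {X G E : Type*} [TopologicalSpace X] [TopologicalSpace G] [TopologicalSpace E]
  {𝒢 : EtaleGroupoid X G} (T : Twist 𝒢 E)

/-- The action of the circle on `Σ`. -/
def act (z : Circle) (σ : E) : E := T.grpd.mul (T.ι (T.grpd.r σ) z) σ (T.s_ι _ z)

theorem mem_reduction_iff (Δ : Set X) (σ : E) :
    σ ∈ T.grpd.reduction Δ ↔ T.q σ ∈ 𝒢.reduction Δ := by
  change _ ∧ _ ↔ _ ∧ _
  rw [T.r_q, T.s_q]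

/-- The restricted twist `Δ × 𝕋 → Σ_Δ → G_Δ` for an invariant set `Δ` of units. -/
def restrict (Δ : Set X) (hΔ : 𝒢.Invariant Δ) :
    Twist (𝒢.restrict Δ hΔ) (T.grpd.reduction Δ) where
  grpd := T.grpd.restrict Δ
  ι x z := ⟨T.ι x z, ⟨(T.r_ι x z).symm ▸ x.2, (T.s_ι x z).symm ▸ x.2⟩⟩
  q σ := ⟨T.q σ, (T.mem_reduction_iff Δ σ).1 σ.2⟩
  r_ι x z := Subtype.ext (T.r_ι x z)
  s_ι x z := Subtype.ext (T.s_ι x z)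
  ι_one x := Subtype.ext (T.ι_one x)
  ι_mul x z w := Subtype.ext (T.ι_mul x z w)
  isEmbedding_ι := (IsEmbedding.of_comp_iff IsEmbedding.subtypeVal).1
    (T.isEmbedding_ι.comp ((IsEmbedding.subtypeVal (p := (· ∈ Δ))).prodMap IsEmbedding.id))
  r_q σ := Subtype.ext (T.r_q σ)
  s_q σ := Subtype.ext (T.s_q σ)
  q_unit x := Subtype.ext (T.q_unit x)
  q_mul σ τ _ := Subtype.ext (T.q_mul σ τ _)
  continuous_q := (T.continuous_q.comp continuous_subtype_val).subtype_mk _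
  surjective_q := by
    rintro ⟨γ, hγ⟩
    obtain ⟨σ, rfl⟩ := T.surjective_q γ
    exact ⟨⟨σ, (T.mem_reduction_iff Δ σ).2 hγ⟩, rfl⟩
  q_eq_unit_iff σ x := Subtype.ext_iff.trans ((T.q_eq_unit_iff σ x).trans
    ⟨fun ⟨z, h⟩ => ⟨z, Subtype.ext h⟩, fun ⟨z, h⟩ => ⟨z, congrArg Subtype.val h⟩⟩)
  central σ z := Subtype.ext (T.central σ z)
  exists_local_section := by
    rintro ⟨γ, hγ⟩
    obtain ⟨B, hB, hmem, S, hS, hqS⟩ := T.exists_local_section γ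
    refine ⟨Subtype.val ⁻¹' B, hB.preimage continuous_subtype_val, hmem,
      fun b => ⟨S ⟨b.1.1, b.2⟩, (T.mem_reduction_iff Δ _).2 (by rw [hqS]; exact b.1.2)⟩,
      ?_, fun b => Subtype.ext (hqS _)⟩
    exact (hS.comp (by fun_prop)).subtype_mk _

/-- `C_c(Σ; G)`: continuous compactly supported `f : Σ → ℂ` with `f (z σ) = z f (σ)`. -/
structure Cc where
  toFun : E → ℂ
  continuous_toFun : Continuous toFun
  hasCompactSupport_toFun : HasCompactSupport toFun
  map_act : ∀ (z : Circle) (σ : E), toFun (T.act z σ) = z * toFun σ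

instance : CoeFun T.Cc fun _ => E → ℂ := ⟨Cc.toFun⟩

/-- A set-theoretic section of `q : Σ → G` (no continuity is required). -/
structure Section where
  toFun : G → E
  q_toFun : ∀ γ, T.q (toFun γ) = γ

instance : CoeFun T.Section fun _ => G → E := ⟨Section.toFun⟩

variable {T}

/-- The restriction of a section to `G_Δ`. -/
def Section.restrict (c : T.Section) (Δ : Set X) (hΔ : 𝒢.Invariant Δ) :
    (T.restrict Δ hΔ).Section where
  toFun γ := ⟨c γ, (T.mem_reduction_iff Δ _).2 (by rw [c.q_toFun]; exact γ.2)⟩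
  q_toFun γ := Subtype.ext (c.q_toFun γ)

end Twist

/-! ### Operators on `ℓ²` -/

/-- The Hilbert space `ℓ²(I)`. -/
noncomputable abbrev HilbertL2 (I : Type*) := lp (fun _ : I => ℂ) 2

namespace HilbertL2

variable {I : Type*}

/-- Matrices with uniformly bounded entries and a uniform bound on the number of nonzero entries
in each row and in each column. -/
structure IsBanded (K : I → I → ℂ) (n : ℕ) (C : ℝ) : Prop where
  row : ∀ i, ∃ R : Finset I, R.card ≤ n ∧ ∀ j, K i j ≠ 0 → j ∈ R
  col : ∀ j, ∃ R : Finset I, R.card ≤ n ∧ ∀ i, K i j ≠ 0 → i ∈ R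
  bound : ∀ i j, ‖K i j‖ ≤ C

theorem IsBanded.summable {K : I → I → ℂ} {n : ℕ} {C : ℝ} (hK : IsBanded K n C)
    (ξ : I → ℂ) (i : I) : Summable fun j => K i j * ξ j := by
  obtain ⟨R, -, hR⟩ := hK.row i
  refine summable_of_ne_finset_zero (s := R) fun j hj => ?_
  rw [show K i j = 0 by by_contra h; exact hj (hR j h), zero_mul]

theorem sum_sq_le_norm_sq (ξ : HilbertL2 I) (t : Finset I) : ∑ i ∈ t, ‖ξ i‖ ^ 2 ≤ ‖ξ‖ ^ 2 := by
  have := lp.sum_rpow_le_norm_rpow (p := 2) (by norm_num) ξ t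
  simpa using this

theorem IsBanded.sum_sq_le {K : I → I → ℂ} {n : ℕ} {C : ℝ} (hK : IsBanded K n C)
    (ξ : HilbertL2 I) (t : Finset I) :
    ∑ i ∈ t, ‖∑' j, K i j * ξ j‖ ^ 2 ≤ (n * C * ‖ξ‖) ^ 2 := by
  classical
  choose R hRc hR using hK.row
  choose R' hRc' hR' using hK.col
  set u : Finset I := t.biUnion R
  have hrow : ∀ i ∈ t, ‖∑' j, K i j * ξ j‖ ^ 2 ≤
      n * C ^ 2 * ∑ j ∈ u, if K i j = 0 then 0 else ‖ξ j‖ ^ 2 := by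
    intro i hi
    have h1 : ∑' j, K i j * ξ j = ∑ j ∈ R i, K i j * ξ j := tsum_eq_sum fun j hj => by
      rw [show K i j = 0 by by_contra h; exact hj (hR i j h), zero_mul]
    have h2 : ‖∑ j ∈ R i, K i j * ξ j‖ ^ 2 ≤ (∑ j ∈ R i, ‖K i j * ξ j‖) ^ 2 := by
      gcongr; exact norm_sum_le _ _
    have h3 := sq_sum_le_card_mul_sum_sq (s := R i) (f := fun j => ‖K i j * ξ j‖)
    have h4 : ∑ j ∈ R i, ‖K i j * ξ j‖ ^ 2 ≤
        ∑ j ∈ u, C ^ 2 * (if K i j = 0 then 0 else ‖ξ j‖ ^ 2) := by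
      refine (Finset.sum_le_sum fun j _ => ?_).trans
        (Finset.sum_le_sum_of_subset_of_nonneg (Finset.subset_biUnion_of_mem R hi) ?_)
      · by_cases h : K i j = 0
        · simp [h]
        · rw [if_neg h, norm_mul, mul_pow]
          gcongr; exact hK.bound i j
      · intro j _ _
        split_ifs <;> positivity
    rw [h1, mul_assoc, Finset.mul_sum]
    calc _ ≤ _ := h2
      _ ≤ _ := h3
      _ ≤ (n : ℝ) * _ := by
        gcongr
        exact hRc i
  calc ∑ i ∈ t, ‖∑' j, K i j * ξ j‖ ^ 2
      ≤ ∑ i ∈ t, n * C ^ 2 * ∑ j ∈ u, (if K i j = 0 then 0 else ‖ξ j‖ ^ 2) :=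
        Finset.sum_le_sum hrow
    _ = n * C ^ 2 * ∑ j ∈ u, ∑ i ∈ t, (if K i j = 0 then 0 else ‖ξ j‖ ^ 2) := by
        rw [← Finset.mul_sum, Finset.sum_comm]
    _ ≤ n * C ^ 2 * ∑ j ∈ u, n * ‖ξ j‖ ^ 2 := by
        gcongr with j _
        rw [Finset.sum_ite, Finset.sum_const_zero, zero_add, Finset.sum_const, nsmul_eq_mul]
        gcongr
        refine (Finset.card_le_card fun i hi => hR' j i (Finset.mem_filter.1 hi).2).trans (hRc' j)
    _ ≤ n * C ^ 2 * (n * ‖ξ‖ ^ 2) := by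
        rw [← Finset.mul_sum]
        gcongr
        exact sum_sq_le_norm_sq ξ u
    _ = _ := by ring

theorem IsBanded.memℓp {K : I → I → ℂ} {n : ℕ} {C : ℝ} (hK : IsBanded K n C)
    (ξ : HilbertL2 I) : Memℓp (fun i => ∑' j, K i j * ξ j) 2 :=
  memℓp_gen' (C := (n * C * ‖ξ‖) ^ 2) fun t => by simpa using hK.sum_sq_le ξ t

/-- The bounded operator `(K ξ)(i) = ∑ⱼ K i j ξ j` of a banded matrix. -/
noncomputable def ofMatrix (K : I → I → ℂ) {n : ℕ} {C : ℝ} (hK : IsBanded K n C) :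
    HilbertL2 I →L[ℂ] HilbertL2 I :=
  LinearMap.mkContinuous
    { toFun := fun ξ => ⟨fun i => ∑' j, K i j * ξ j, hK.memℓp ξ⟩
      map_add' := fun ξ η => lp.ext <| funext fun i => by
        change ∑' j, K i j * (ξ j + η j) = ∑' j, K i j * ξ j + ∑' j, K i j * η j
        simp only [mul_add]
        exact (hK.summable ξ i).tsum_add (hK.summable η i)
      map_smul' := fun a ξ => lp.ext <| funext fun i => by
        change ∑' j, K i j * (a * ξ j) = a * ∑' j, K i j * ξ j
        rw [← tsum_mul_left]
        exact tsum_congr fun j => by ring }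
    (n * |C|) fun ξ => lp.norm_le_of_forall_sum_le (p := 2) (by norm_num) (by positivity) fun t => by
      have h := hK.sum_sq_le ξ t
      have e : (n * C * ‖ξ‖) ^ 2 = (n * |C| * ‖ξ‖) ^ 2 := by
        rw [mul_pow, mul_pow, mul_pow, mul_pow, sq_abs]
      simpa [e] using h

@[simp]
theorem ofMatrix_apply (K : I → I → ℂ) {n : ℕ} {C : ℝ} (hK : IsBanded K n C)
    (ξ : HilbertL2 I) (i : I) : ofMatrix K hK ξ i = ∑' j, K i j * ξ j := rfl

/-- The restriction map `ℓ²(I) → ℓ²(S)` for a subset `S` of `I`. -/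
noncomputable def res (S : Set I) : HilbertL2 I →L[ℂ] HilbertL2 S :=
  LinearMap.mkContinuous
    { toFun := fun ξ => ⟨fun i => ξ i, memℓp_gen' (C := ‖ξ‖ ^ 2) fun t => by
        simpa using sum_sq_le_norm_sq ξ (t.map (Function.Embedding.subtype _))⟩
      map_add' := fun _ _ => rfl
      map_smul' := fun _ _ => rfl }
    1 fun ξ => lp.norm_le_of_forall_sum_le (p := 2) (by norm_num) (by positivity) fun t => by
      change ∑ i ∈ t, ‖ξ i‖ ^ _ ≤ _
      simpa using sum_sq_le_norm_sq ξ (t.map (Function.Embedding.subtype _))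

/-- The inclusion `ℓ²(S) → ℓ²(I)` by extension by zero. -/
noncomputable def incl (S : Set I) : HilbertL2 S →L[ℂ] HilbertL2 I :=
  ContinuousLinearMap.adjoint (res S)

theorem res_apply (S : Set I) (ξ : HilbertL2 I) (i : S) : res S ξ i = ξ i := rfl

open scoped InnerProductSpace in
theorem inner_single {J : Type*} [DecidableEq J] (j : J) (ξ : HilbertL2 J) :
    ⟪lp.single 2 j (1 : ℂ), ξ⟫_ℂ = ξ j := by
  rw [lp.inner_single_left]; simp

theorem incl_apply_mem (S : Set I) (ξ : HilbertL2 S) (i : S) : incl S ξ i = ξ i := by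
  classical
  rw [← inner_single, incl, ContinuousLinearMap.adjoint_inner_right, ← inner_single]
  congr 1
  refine lp.ext <| funext fun j => ?_
  rw [res_apply, lp.single_apply, lp.single_apply]
  simp [Pi.single_apply, Subtype.ext_iff]

theorem incl_apply_notMem (S : Set I) (ξ : HilbertL2 S) {i : I} (hi : i ∉ S) :
    incl S ξ i = 0 := by
  classical
  rw [← inner_single, incl, ContinuousLinearMap.adjoint_inner_right]
  have : res S (lp.single 2 i (1 : ℂ)) = 0 := by
    refine lp.ext <| funext fun j => ?_
    rw [res_apply, lp.single_apply, Pi.single_eq_of_ne]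
    · rfl
    · rintro rfl; exact hi j.2
  rw [this, inner_zero_left]

theorem res_comp_incl (S : Set I) : (res S).comp (incl S) = ContinuousLinearMap.id ℂ _ :=
  ContinuousLinearMap.ext fun ξ => lp.ext <| funext fun i => by
    rw [ContinuousLinearMap.comp_apply, res_apply, incl_apply_mem]; rfl

theorem adjoint_incl (S : Set I) : ContinuousLinearMap.adjoint (incl S) = res S :=
  ContinuousLinearMap.adjoint_adjoint _

end HilbertL2

namespace EtaleGroupoid

variable {X G : Type*} [TopologicalSpace X] [TopologicalSpace G] (𝒢 : EtaleGroupoid X G)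

theorem exists_nhds_injOn (γ : G) : ∃ B ∈ 𝓝 γ, Set.InjOn 𝒢.r B ∧ Set.InjOn 𝒢.s B := by
  obtain ⟨U, hU, hr⟩ := isLocalHomeomorph_iff_isOpenEmbedding_restrict.1 𝒢.isLocalHomeomorph_r γ
  obtain ⟨V, hV, hs⟩ := isLocalHomeomorph_iff_isOpenEmbedding_restrict.1 𝒢.isLocalHomeomorph_s γ
  exact ⟨U ∩ V, Filter.inter_mem hU hV,
    (Set.injOn_iff_injective.2 hr.injective).mono Set.inter_subset_left,
    (Set.injOn_iff_injective.2 hs.injective).mono Set.inter_subset_right⟩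

end EtaleGroupoid

namespace Twist

variable {X G E : Type*} [TopologicalSpace X] [TopologicalSpace G] [TopologicalSpace E]
  {𝒢 : EtaleGroupoid X G} {T : Twist 𝒢 E}

theorem Section.s_eq (c : T.Section) (γ : G) : T.grpd.s (c γ) = 𝒢.s γ := by
  rw [← T.s_q, c.q_toFun]

theorem Section.r_eq (c : T.Section) (γ : G) : T.grpd.r (c γ) = 𝒢.r γ := by
  rw [← T.r_q, c.q_toFun]

theorem Section.composable (c : T.Section) {γ η : G} (h : 𝒢.s γ = 𝒢.s η) :
    T.grpd.s (c γ) = T.grpd.r (T.grpd.inv (c η)) := by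
  rw [T.grpd.r_inv, c.s_eq, c.s_eq, h]

theorem q_inv (T : Twist 𝒢 E) (σ : E) : T.q (T.grpd.inv σ) = 𝒢.inv (T.q σ) := by
  refine (TopGroupoid.inv_eq_of_mul_eq_unit (𝒢 := 𝒢.toTopGroupoid) ?_ ?_).symm
  · rw [T.s_q, T.r_q, T.grpd.r_inv]
  · rw [← T.q_mul _ _ (T.grpd.r_inv σ).symm, T.grpd.mul_inv, T.q_unit, T.r_q]

theorem Section.q_mul_inv (c : T.Section) {γ η : G} (h : 𝒢.s γ = 𝒢.s η) :
    T.q (T.grpd.mul (c γ) (T.grpd.inv (c η)) (c.composable h)) =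
      𝒢.mul γ (𝒢.inv η) (h.trans (𝒢.r_inv η).symm) := by
  rw [T.q_mul]
  exact TopGroupoid.mul_congr (c.q_toFun γ) ((T.q_inv _).trans (by rw [c.q_toFun])) _

open Classical in
/-- The matrix `f(c(γ) c(η)⁻¹)` (zero unless `s(γ) = s(η)`) of left convolution by `f`. -/
noncomputable def Section.matrix (c : T.Section) (f : T.Cc) (γ η : G) : ℂ :=
  if h : 𝒢.s γ = 𝒢.s η then
    f (T.grpd.mul (c γ) (T.grpd.inv (c η)) (c.composable h))
  else 0

theorem Section.exists_isBanded (c : T.Section) (f : T.Cc) :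
    ∃ n : ℕ, ∃ C : ℝ, HilbertL2.IsBanded (c.matrix f) n C := by
  classical
  obtain ⟨C, hC⟩ := f.hasCompactSupport_toFun.exists_bound_of_continuous f.continuous_toFun
  have hC0 : 0 ≤ max C 0 := le_max_right _ _
  choose B hB hBr hBs using 𝒢.exists_nhds_injOn
  obtain ⟨t, -, ht⟩ := (f.hasCompactSupport_toFun.isCompact.image T.continuous_q).elim_nhds_subcover
    B fun x _ => hB x
  have key : ∀ γ η, c.matrix f γ η ≠ 0 → ∃ h : 𝒢.s γ = 𝒢.s η, ∃ g ∈ t,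
      𝒢.mul γ (𝒢.inv η) (h.trans (𝒢.r_inv η).symm) ∈ B g := by
    intro γ η hne
    by_cases h : 𝒢.s γ = 𝒢.s η
    · rw [Section.matrix, dif_pos h] at hne
      have := ht (Set.mem_image_of_mem T.q (subset_tsupport _ (Function.mem_support.2 hne)))
      rw [c.q_mul_inv h] at this
      simpa [h] using this
    · exact absurd (by rw [Section.matrix, dif_neg h]) hne
  have card : ∀ (P : G → Prop) (R : G → G → Prop), (∀ η, P η → ∃ g ∈ t, R g η) →
      (∀ g η η', P η → P η' → R g η → R g η' → η = η') →
      ∃ F : Finset G, F.card ≤ t.card ∧ ∀ η, P η → η ∈ F := by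
    intro P R h1 h2
    refine ⟨t.image fun g => if h : ∃ η, P η ∧ R g η then h.choose else g,
      Finset.card_image_le, fun η hη => ?_⟩
    obtain ⟨g, hg, hR⟩ := h1 η hη
    have hex : ∃ η, P η ∧ R g η := ⟨η, hη, hR⟩
    refine Finset.mem_image.2 ⟨g, hg, ?_⟩
    rw [dif_pos hex]
    exact h2 g _ _ hex.choose_spec.1 hη hex.choose_spec.2 hR
  refine ⟨t.card, max C 0, fun γ => ?_, fun η => ?_, fun γ η => ?_⟩
  · refine card _ (fun g η => ∃ h : 𝒢.s γ = 𝒢.s η,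
      𝒢.mul γ (𝒢.inv η) (h.trans (𝒢.r_inv η).symm) ∈ B g)
      (fun η hη => by obtain ⟨h, g, hg, hm⟩ := key γ η hη; exact ⟨g, hg, h, hm⟩) ?_
    rintro g η η' - - ⟨h, hm⟩ ⟨h', hm'⟩
    have e := hBr g hm hm' (by rw [𝒢.r_mul, 𝒢.r_mul])
    exact TopGroupoid.inv_injective (TopGroupoid.mul_left_cancel e)
  · refine card (fun γ => c.matrix f γ η ≠ 0) (fun g γ => ∃ h : 𝒢.s γ = 𝒢.s η,
      𝒢.mul γ (𝒢.inv η) (h.trans (𝒢.r_inv η).symm) ∈ B g)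
      (fun γ hγ => by obtain ⟨h, g, hg, hm⟩ := key γ η hγ; exact ⟨g, hg, h, hm⟩) ?_
    rintro g γ γ' - - ⟨h, hm⟩ ⟨h', hm'⟩
    have e := hBs g hm hm' (by rw [𝒢.s_mul, 𝒢.s_mul])
    exact TopGroupoid.mul_right_cancel e
  · rw [Section.matrix]
    split_ifs with h
    · exact (hC _).trans (le_max_left _ _)
    · simp

/-- The regular representation of `C_c(Σ; G)` on `⨁ₓ L²(Σₓ; Gₓ)`, where `L²(Σₓ; Gₓ)` is identified
with `ℓ²(Gₓ)` through `ξ ↦ ξ ∘ c`, so that the Hilbert space is `ℓ²(G)`: left convolution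
`(f * ξ)(γ) = ∑_{s(η) = s(γ)} f(c(γ) c(η)⁻¹) ξ(η)`. -/
noncomputable def Section.leftRegular (c : T.Section) (f : T.Cc) :
    HilbertL2 G →L[ℂ] HilbertL2 G :=
  HilbertL2.ofMatrix (c.matrix f) (c.exists_isBanded f).choose_spec.choose_spec

theorem Section.leftRegular_apply (c : T.Section) (f : T.Cc) (ξ : HilbertL2 G) (γ : G) :
    c.leftRegular f ξ γ = ∑' η, c.matrix f γ η * ξ η := rfl

/-- The reduced `C*`-algebra `C*_r(Σ; G)`: the norm closure of the `*`-algebra generated by the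
image of `C_c(Σ; G)` under the regular representation. -/
noncomputable def Section.reducedAlgebra (c : T.Section) :
    NonUnitalStarSubalgebra ℂ (HilbertL2 G →L[ℂ] HilbertL2 G) :=
  (NonUnitalStarAlgebra.adjoin ℂ (Set.range c.leftRegular)).topologicalClosure

theorem Section.leftRegular_mem (c : T.Section) (f : T.Cc) :
    c.leftRegular f ∈ c.reducedAlgebra :=
  NonUnitalStarSubalgebra.le_topologicalClosure _
    (NonUnitalStarAlgebra.subset_adjoin ℂ _ (Set.mem_range_self f))

end Twist

namespace HilbertL2

variable {I : Type*} (S : Set I)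

theorem res_incl (ξ : HilbertL2 S) : res S (incl S ξ) = ξ := congrArg (· ξ) (res_comp_incl S)

/-- The embedding `B(ℓ²(S)) → B(ℓ²(I))` that extends operators by zero. -/
noncomputable def extendOp :
    (HilbertL2 S →L[ℂ] HilbertL2 S) →⋆ₙₐ[ℂ] (HilbertL2 I →L[ℂ] HilbertL2 I) where
  toFun b := (incl S).comp (b.comp (res S))
  map_smul' z b := by ext1 ξ; simp
  map_zero' := by simp
  map_add' b b' := by ext1 ξ; simp
  map_mul' b b' := by ext1 ξ; simp [res_incl]
  map_star' b := by
    simp only [ContinuousLinearMap.star_eq_adjoint, ContinuousLinearMap.adjoint_comp, adjoint_incl]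
    rfl

/-- The compression of operators from `ℓ²(I)` to `ℓ²(S)`. -/
noncomputable def compress :
    (HilbertL2 I →L[ℂ] HilbertL2 I) →L[ℂ] (HilbertL2 S →L[ℂ] HilbertL2 S) :=
  (ContinuousLinearMap.compL ℂ (HilbertL2 S) (HilbertL2 I) (HilbertL2 S) (res S)).comp
    ((ContinuousLinearMap.compL ℂ (HilbertL2 S) (HilbertL2 I) (HilbertL2 I)).flip (incl S))

theorem compress_apply (a : HilbertL2 I →L[ℂ] HilbertL2 I) (ξ : HilbertL2 S) :
    compress S a ξ = res S (a (incl S ξ)) := rfl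

theorem compress_star (a : HilbertL2 I →L[ℂ] HilbertL2 I) :
    compress S (star a) = star (compress S a) := by
  change (res S).comp ((star a).comp (incl S)) = star ((res S).comp (a.comp (incl S)))
  simp only [ContinuousLinearMap.star_eq_adjoint, ContinuousLinearMap.adjoint_comp, adjoint_incl]
  rfl

theorem continuous_extendOp : Continuous (extendOp S) := by
  change Continuous fun b : HilbertL2 S →L[ℂ] HilbertL2 S => (incl S).comp (b.comp (res S))
  fun_prop

/-- The projection of `ℓ²(I)` onto `ℓ²(S)`. -/
noncomputable def proj : HilbertL2 I →L[ℂ] HilbertL2 I := (incl S).comp (res S)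

theorem star_proj : star (proj S) = proj S := by
  rw [ContinuousLinearMap.star_eq_adjoint, proj, ContinuousLinearMap.adjoint_comp, adjoint_incl]
  rfl

theorem compress_mul {a : HilbertL2 I →L[ℂ] HilbertL2 I} (ha : Commute a (proj S))
    (b : HilbertL2 I →L[ℂ] HilbertL2 I) : compress S (a * b) = compress S a * compress S b := by
  ext1 ξ
  have h := congrArg (fun T => res S (T (b (incl S ξ)))) ha.eq
  change res S (a (incl S (res S (b (incl S ξ))))) =
    res S (incl S (res S (a (b (incl S ξ))))) at h
  rw [res_incl] at h
  exact h.symm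

/-- The operators that commute with the projection onto `ℓ²(S)` and whose compression to `ℓ²(S)`
lies in `B`. -/
noncomputable def liftAlgebra
    (B : NonUnitalStarSubalgebra ℂ (HilbertL2 S →L[ℂ] HilbertL2 S)) :
    NonUnitalStarSubalgebra ℂ (HilbertL2 I →L[ℂ] HilbertL2 I) where
  carrier := {a | Commute a (proj S) ∧ compress S a ∈ B}
  add_mem' ha hb := ⟨ha.1.add_left hb.1, by rw [map_add]; exact add_mem ha.2 hb.2⟩
  zero_mem' := ⟨Commute.zero_left _, by rw [map_zero]; exact zero_mem _⟩
  mul_mem' ha hb := ⟨ha.1.mul_left hb.1, by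
    rw [compress_mul S ha.1]; exact mul_mem ha.2 hb.2⟩
  smul_mem' z a ha := ⟨ha.1.smul_left z, by
    rw [map_smul]; exact SMulMemClass.smul_mem z ha.2⟩
  star_mem' {a} ha := ⟨by
    have := ha.1.star_star
    rwa [star_proj] at this, by rw [compress_star]; exact star_mem ha.2⟩

theorem mem_liftAlgebra {S : Set I} {B : NonUnitalStarSubalgebra ℂ (HilbertL2 S →L[ℂ] HilbertL2 S)}
    {a : HilbertL2 I →L[ℂ] HilbertL2 I} :
    a ∈ liftAlgebra S B ↔ Commute a (proj S) ∧ compress S a ∈ B := Iff.rfl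

theorem isClosed_liftAlgebra (B : NonUnitalStarSubalgebra ℂ (HilbertL2 S →L[ℂ] HilbertL2 S))
    (hB : IsClosed (B : Set (HilbertL2 S →L[ℂ] HilbertL2 S))) :
    IsClosed (liftAlgebra S B : Set (HilbertL2 I →L[ℂ] HilbertL2 I)) := by
  refine IsClosed.inter ?_ (hB.preimage (compress S).continuous)
  change IsClosed {a | a * proj S = proj S * a}
  exact isClosed_eq (by fun_prop) (by fun_prop)

end HilbertL2

namespace Twist

variable {X G E : Type*} [TopologicalSpace X] [TopologicalSpace G] [TopologicalSpace E]
  {𝒢 : EtaleGroupoid X G} {T : Twist 𝒢 E}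

theorem restrict_act (Δ : Set X) (hΔ : 𝒢.Invariant Δ) (z : Circle) (σ : T.grpd.reduction Δ) :
    ((T.restrict Δ hΔ).act z σ : E) = T.act z σ := rfl

theorem r_act (z : Circle) (σ : E) : T.grpd.r (T.act z σ) = T.grpd.r σ := by
  rw [act, T.grpd.r_mul, T.r_ι]

theorem s_act (z : Circle) (σ : E) : T.grpd.s (T.act z σ) = T.grpd.s σ := by
  rw [act, T.grpd.s_mul]

theorem act_mem_reduction_iff (Δ : Set X) (z : Circle) (σ : E) :
    T.act z σ ∈ T.grpd.reduction Δ ↔ σ ∈ T.grpd.reduction Δ := by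
  change _ ∧ _ ↔ _ ∧ _
  rw [r_act, s_act]

/-- Restriction of functions to `Σ_F`, for closed `F`. -/
def Cc.restrict (f : T.Cc) (F : Set X) (hF : 𝒢.Invariant F) (hcl : IsClosed F) :
    (T.restrict F hF).Cc where
  toFun σ := f σ
  continuous_toFun := f.continuous_toFun.comp continuous_subtype_val
  hasCompactSupport_toFun := f.hasCompactSupport_toFun.comp_isClosedEmbedding
    ((hcl.preimage T.grpd.continuous_r).inter
      (hcl.preimage T.grpd.continuous_s)).isClosedEmbedding_subtypeVal
  map_act z σ := f.map_act z σ

/-- Extension of functions by zero from `Σ_U`, for open `U`. -/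
noncomputable def Cc.extend [T2Space E] {U : Set X} {hU : 𝒢.Invariant U} (hop : IsOpen U)
    (f : (T.restrict U hU).Cc) : T.Cc where
  toFun := Function.extend Subtype.val f.toFun 0
  continuous_toFun := HasCompactSupport.continuous_extend_zero ((hop.preimage T.grpd.continuous_r).inter
    (hop.preimage T.grpd.continuous_s)) f.continuous_toFun f.hasCompactSupport_toFun
  hasCompactSupport_toFun := f.hasCompactSupport_toFun.extend_zero continuous_subtype_val
  map_act z σ := by
    by_cases h : σ ∈ T.grpd.reduction U
    · have h' := (act_mem_reduction_iff U z σ).2 h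
      have e := f.map_act z ⟨σ, h⟩
      have e1 := Subtype.val_injective.extend_apply f.toFun 0 ⟨σ, h⟩
      have e2 := Subtype.val_injective.extend_apply f.toFun 0 ⟨_, h'⟩
      rw [e1, e2, ← e]; rfl
    · have h' := mt (act_mem_reduction_iff U z σ).1 h
      rw [Function.extend_apply' _ _ _ (fun ⟨a, ha⟩ => h' (ha ▸ a.2)),
        Function.extend_apply' _ _ _ (fun ⟨a, ha⟩ => h (ha ▸ a.2))]
      simp

theorem Section.matrix_restrict (c : T.Section) (f : T.Cc) {F : Set X} (hF : 𝒢.Invariant F)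
    (hcl : IsClosed F) (γ η : 𝒢.reduction F) :
    (c.restrict F hF).matrix (f.restrict F hF hcl) γ η = c.matrix f γ η := by
  unfold Section.matrix
  by_cases h : 𝒢.s (γ : G) = 𝒢.s η
  · rw [dif_pos h, dif_pos (Subtype.ext h)]; rfl
  · rw [dif_neg h, dif_neg (fun h' => h (congrArg Subtype.val h'))]

theorem Section.matrix_extend [T2Space E] (c : T.Section) {U : Set X} {hU : 𝒢.Invariant U}
    (hop : IsOpen U) (f : (T.restrict U hU).Cc) (γ η : 𝒢.reduction U) :
    c.matrix (f.extend hop) γ η = (c.restrict U hU).matrix f γ η := by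
  unfold Section.matrix
  by_cases h : 𝒢.s (γ : G) = 𝒢.s η
  · have h' : (𝒢.restrict U hU).s γ = (𝒢.restrict U hU).s η := Subtype.ext h
    rw [dif_pos h, dif_pos h']
    exact Subtype.val_injective.extend_apply f.toFun 0
      ((T.restrict U hU).grpd.mul (c.restrict U hU γ)
        ((T.restrict U hU).grpd.inv (c.restrict U hU η)) _)
  · rw [dif_neg h, dif_neg (fun h' => h (congrArg Subtype.val h'))]

theorem Section.matrix_eq_zero (c : T.Section) (f : T.Cc) {γ η : G} (h : 𝒢.s γ ≠ 𝒢.s η) :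
    c.matrix f γ η = 0 := dif_neg h

theorem Section.matrix_extend_eq_zero [T2Space E] (c : T.Section) {U : Set X}
    {hU : 𝒢.Invariant U} (hop : IsOpen U) (f : (T.restrict U hU).Cc) {γ : G} (η : G)
    (hγ : γ ∉ 𝒢.reduction U) : c.matrix (f.extend hop) γ η = 0 := by
  unfold Section.matrix
  split_ifs with h
  · refine Function.extend_apply' _ _ _ ?_
    rintro ⟨a, ha⟩
    have := a.2.1
    rw [ha, T.grpd.r_mul, c.r_eq] at this
    exact hγ ⟨this, (hU.range_mem_iff γ).1 this⟩
  · rfl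

theorem Section.mem_reduction_of_s_eq {Δ : Set X} (hΔ : 𝒢.Invariant Δ) {γ η : G}
    (h : 𝒢.s γ = 𝒢.s η) (hη : η ∈ 𝒢.reduction Δ) : γ ∈ 𝒢.reduction Δ :=
  (hΔ.mem_reduction_iff γ).2 (h ▸ hη.2)

theorem Section.leftRegular_apply_mem (c : T.Section) (f : T.Cc) {Δ : Set X}
    (hΔ : 𝒢.Invariant Δ) (ξ : HilbertL2 G) (γ : 𝒢.reduction Δ) :
    c.leftRegular f ξ γ = ∑' η : 𝒢.reduction Δ, c.matrix f γ η * ξ η := by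
  rw [c.leftRegular_apply]
  refine (tsum_subtype_eq_of_support_subset (f := fun η => c.matrix f γ η * ξ η) ?_).symm
  intro η hη
  by_contra hη'
  refine hη ?_
  change c.matrix f γ η * ξ η = 0
  rw [c.matrix_eq_zero f fun h => hη' (mem_reduction_of_s_eq hΔ h.symm γ.2), zero_mul]

/-- Every `ℓ²(G_Δ)` with `Δ` invariant reduces the regular representation. -/
theorem Section.res_leftRegular_eq_zero (c : T.Section) (f : T.Cc) {Δ : Set X}
    (hΔ : 𝒢.Invariant Δ) (ξ : HilbertL2 (𝒢.reduction Δ)) {γ : G} (hγ : γ ∉ 𝒢.reduction Δ) :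
    c.leftRegular f (HilbertL2.incl _ ξ) γ = 0 := by
  rw [c.leftRegular_apply]
  refine (tsum_congr fun η => ?_).trans tsum_zero
  by_cases hη : η ∈ 𝒢.reduction Δ
  · rw [c.matrix_eq_zero f fun h => hγ (mem_reduction_of_s_eq hΔ h hη), zero_mul]
  · rw [HilbertL2.incl_apply_notMem _ _ hη, mul_zero]

theorem Section.commute_proj (c : T.Section) (f : T.Cc) {Δ : Set X} (hΔ : 𝒢.Invariant Δ) :
    Commute (c.leftRegular f) (HilbertL2.proj (𝒢.reduction Δ)) := by
  refine ContinuousLinearMap.ext fun ξ => lp.ext <| funext fun γ => ?_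
  change c.leftRegular f (HilbertL2.incl _ (HilbertL2.res _ ξ)) γ =
    HilbertL2.incl _ (HilbertL2.res _ (c.leftRegular f ξ)) γ
  by_cases hγ : γ ∈ 𝒢.reduction Δ
  · lift γ to 𝒢.reduction Δ using hγ
    rw [HilbertL2.incl_apply_mem, HilbertL2.res_apply, c.leftRegular_apply_mem f hΔ,
      c.leftRegular_apply_mem f hΔ]
    refine tsum_congr fun η => ?_
    rw [HilbertL2.incl_apply_mem, HilbertL2.res_apply]
  · rw [HilbertL2.incl_apply_notMem _ _ hγ, c.res_leftRegular_eq_zero f hΔ _ hγ]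

theorem Section.compress_leftRegular (c : T.Section) (f : T.Cc) {F : Set X} (hF : 𝒢.Invariant F)
    (hcl : IsClosed F) : HilbertL2.compress (𝒢.reduction F) (c.leftRegular f) =
      (c.restrict F hF).leftRegular (f.restrict F hF hcl) := by
  refine ContinuousLinearMap.ext fun ξ => lp.ext <| funext fun γ => ?_
  rw [HilbertL2.compress_apply, HilbertL2.res_apply, c.leftRegular_apply_mem f hF,
    Section.leftRegular_apply]
  refine tsum_congr fun η => ?_
  rw [HilbertL2.incl_apply_mem, c.matrix_restrict f hF hcl]

theorem Section.extendOp_leftRegular [T2Space E] (c : T.Section) {U : Set X}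
    {hU : 𝒢.Invariant U} (hop : IsOpen U) (f : (T.restrict U hU).Cc) :
    HilbertL2.extendOp (𝒢.reduction U) ((c.restrict U hU).leftRegular f) =
      c.leftRegular (f.extend hop) := by
  refine ContinuousLinearMap.ext fun ξ => lp.ext <| funext fun γ => ?_
  change HilbertL2.incl _ ((c.restrict U hU).leftRegular f (HilbertL2.res _ ξ)) γ = _
  by_cases hγ : γ ∈ 𝒢.reduction U
  · lift γ to 𝒢.reduction U using hγ
    rw [HilbertL2.incl_apply_mem, c.leftRegular_apply_mem _ hU, Section.leftRegular_apply]
    refine tsum_congr fun η => ?_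
    rw [HilbertL2.res_apply, c.matrix_extend hop]
  · rw [HilbertL2.incl_apply_notMem _ _ hγ, c.leftRegular_apply]
    refine ((tsum_congr fun η => ?_).trans tsum_zero).symm
    rw [c.matrix_extend_eq_zero hop f η hγ, zero_mul]

theorem Section.extendOp_mem [T2Space E] (c : T.Section) {U : Set X} (hU : 𝒢.Invariant U)
    (hop : IsOpen U) : (c.restrict U hU).reducedAlgebra ≤
      c.reducedAlgebra.comap (HilbertL2.extendOp (𝒢.reduction U)) := by
  refine NonUnitalStarSubalgebra.topologicalClosure_minimal _ ?_ ?_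
  · rw [NonUnitalStarAlgebra.adjoin_le_iff]
    rintro _ ⟨f, rfl⟩
    change HilbertL2.extendOp (𝒢.reduction U) ((c.restrict U hU).leftRegular f) ∈
      c.reducedAlgebra
    rw [c.extendOp_leftRegular hop]
    exact c.leftRegular_mem _
  · exact (NonUnitalStarSubalgebra.isClosed_topologicalClosure _).preimage
      (HilbertL2.continuous_extendOp _)

theorem Section.reducedAlgebra_le_lift (c : T.Section) {F : Set X} (hF : 𝒢.Invariant F)
    (hcl : IsClosed F) : c.reducedAlgebra ≤
      HilbertL2.liftAlgebra (𝒢.reduction F) (c.restrict F hF).reducedAlgebra := by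
  refine NonUnitalStarSubalgebra.topologicalClosure_minimal _ ?_
    (HilbertL2.isClosed_liftAlgebra _ _ (NonUnitalStarSubalgebra.isClosed_topologicalClosure _))
  rw [NonUnitalStarAlgebra.adjoin_le_iff]
  rintro _ ⟨f, rfl⟩
  refine HilbertL2.mem_liftAlgebra.2 ⟨c.commute_proj f hF, ?_⟩
  rw [c.compress_leftRegular f hF hcl]
  exact Section.leftRegular_mem _ _

theorem Section.compress_mem (c : T.Section) {F : Set X} (hF : 𝒢.Invariant F)
    (hcl : IsClosed F) {a : HilbertL2 G →L[ℂ] HilbertL2 G} (ha : a ∈ c.reducedAlgebra) :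
    HilbertL2.compress (𝒢.reduction F) a ∈ (c.restrict F hF).reducedAlgebra :=
  (HilbertL2.mem_liftAlgebra.1 (c.reducedAlgebra_le_lift hF hcl ha)).2

theorem Section.commute_proj_of_mem (c : T.Section) {F : Set X} (hF : 𝒢.Invariant F)
    (hcl : IsClosed F) {a : HilbertL2 G →L[ℂ] HilbertL2 G} (ha : a ∈ c.reducedAlgebra) :
    Commute a (HilbertL2.proj (𝒢.reduction F)) :=
  (HilbertL2.mem_liftAlgebra.1 (c.reducedAlgebra_le_lift hF hcl ha)).1

/-- The embedding `C*_r(Σ_U; G_U) → C*_r(Σ; G)` that extends functions by zero, for an invariant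
open set `U` of units. -/
noncomputable def Section.inclusionHom [T2Space E] (c : T.Section) (U : Set X)
    (hU : 𝒢.Invariant U) (hop : IsOpen U) :
    (c.restrict U hU).reducedAlgebra →⋆ₙₐ[ℂ] c.reducedAlgebra :=
  NonUnitalStarAlgHom.codRestrict
    ((HilbertL2.extendOp (𝒢.reduction U)).comp
      (NonUnitalStarSubalgebraClass.subtype (c.restrict U hU).reducedAlgebra))
    c.reducedAlgebra fun b => c.extendOp_mem hU hop b.2

theorem Section.inclusionHom_leftRegular [T2Space E] (c : T.Section) (U : Set X)
    (hU : 𝒢.Invariant U) (hop : IsOpen U) (f : (T.restrict U hU).Cc) :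
    c.inclusionHom U hU hop ⟨(c.restrict U hU).leftRegular f, Section.leftRegular_mem _ f⟩ =
      ⟨c.leftRegular (f.extend hop), c.leftRegular_mem _⟩ :=
  Subtype.ext (c.extendOp_leftRegular hop f)

/-- The `*`-homomorphism `C*_r(Σ; G) → C*_r(Σ_F; G_F)` that restricts functions, for an invariant
closed set `F` of units. -/
noncomputable def Section.restrictionHom (c : T.Section) (F : Set X) (hF : 𝒢.Invariant F)
    (hcl : IsClosed F) : c.reducedAlgebra →⋆ₙₐ[ℂ] (c.restrict F hF).reducedAlgebra where
  toFun a := ⟨HilbertL2.compress (𝒢.reduction F) a, c.compress_mem hF hcl a.2⟩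
  map_smul' z a := Subtype.ext ((HilbertL2.compress (𝒢.reduction F)).map_smul z a.1)
  map_zero' := Subtype.ext (HilbertL2.compress (𝒢.reduction F)).map_zero
  map_add' a b := Subtype.ext ((HilbertL2.compress (𝒢.reduction F)).map_add a.1 b.1)
  map_mul' a b := Subtype.ext (HilbertL2.compress_mul (𝒢.reduction F)
    (c.commute_proj_of_mem hF hcl a.2) b.1)
  map_star' a := Subtype.ext (HilbertL2.compress_star (𝒢.reduction F) a.1)

theorem Section.restrictionHom_leftRegular (c : T.Section) (F : Set X) (hF : 𝒢.Invariant F)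
    (hcl : IsClosed F) (f : T.Cc) :
    c.restrictionHom F hF hcl ⟨c.leftRegular f, c.leftRegular_mem f⟩ =
      ⟨(c.restrict F hF).leftRegular (f.restrict F hF hcl), Section.leftRegular_mem _ _⟩ :=
  Subtype.ext (c.compress_leftRegular f hF hcl)

/-- Inner exactness: for every invariant open set `U` of units the sequence
`C*_r(Σ_U; G_U) → C*_r(Σ; G) → C*_r(Σ_F; G_F)`, `F = X \ U`, is exact in the middle. -/
def Section.InnerExact [T2Space E] (c : T.Section) : Prop :=
  ∀ (U : Set X) (hU : 𝒢.Invariant U) (hop : IsOpen U),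
    Function.Exact (c.inclusionHom U hU hop)
      (c.restrictionHom Uᶜ hU.compl hop.isClosed_compl)

end Twist

namespace HilbertL2

variable {I : Type*}

open Classical in
theorem isBanded_diagonal (a : I → ℂ) {C : ℝ} (hC : 0 ≤ C) (ha : ∀ i, ‖a i‖ ≤ C) :
    IsBanded (fun i j => if i = j then a i else 0) 1 C where
  row i := ⟨{i}, by simp, fun j hj => by
    by_contra h; exact hj (if_neg fun e => h (by simp [e]))⟩
  col j := ⟨{j}, by simp, fun i hi => by
    by_contra h; exact hi (if_neg fun e => h (by simp [e]))⟩
  bound i j := by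
    split_ifs
    · exact ha i
    · simpa using hC

/-- Pointwise multiplication by a bounded function on `ℓ²(I)`. -/
noncomputable def diagonal (a : I → ℂ) {C : ℝ} (hC : 0 ≤ C) (ha : ∀ i, ‖a i‖ ≤ C) :
    HilbertL2 I →L[ℂ] HilbertL2 I :=
  ofMatrix _ (isBanded_diagonal a hC ha)

theorem diagonal_apply (a : I → ℂ) {C : ℝ} (hC : 0 ≤ C) (ha : ∀ i, ‖a i‖ ≤ C)
    (ξ : HilbertL2 I) (i : I) : diagonal a hC ha ξ i = a i * ξ i := by
  classical
  rw [diagonal, ofMatrix_apply, tsum_eq_single i]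
  · rw [if_pos rfl]
  · intro j hj
    rw [if_neg hj.symm, zero_mul]

theorem norm_diagonal_le (a : I → ℂ) {C : ℝ} (hC : 0 ≤ C) (ha : ∀ i, ‖a i‖ ≤ C) :
    ‖diagonal a hC ha‖ ≤ C := by
  refine ContinuousLinearMap.opNorm_le_bound _ hC fun ξ =>
    lp.norm_le_of_forall_sum_le (p := 2) (by norm_num) (by positivity) fun t => ?_
  have h : ∑ i ∈ t, ‖diagonal a hC ha ξ i‖ ^ 2 ≤ (C * ‖ξ‖) ^ 2 := by
    calc _ ≤ ∑ i ∈ t, C ^ 2 * ‖ξ i‖ ^ 2 := by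
          refine Finset.sum_le_sum fun i _ => ?_
          rw [diagonal_apply, norm_mul, mul_pow]
          gcongr
          exact ha i
      _ ≤ _ := by
          rw [← Finset.mul_sum, mul_pow]
          gcongr
          exact sum_sq_le_norm_sq ξ t
  simpa using h

end HilbertL2

namespace Twist

variable {X G E : Type*} [TopologicalSpace X] [TopologicalSpace G] [TopologicalSpace E]
  {𝒢 : EtaleGroupoid X G} {T : Twist 𝒢 E}

open scoped ZeroAtInfty InnerProductSpace

/-- A function `h ∈ C₀(X)` acts on `ℓ²(G)` as multiplication by `h ∘ r`; for `h ∈ C_c(X)` this is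
the operator of the function on `Σ` that is `z h(x)` at `ι(x, z)` and zero off the range of `ι`. -/
noncomputable def unitOp (𝒢 : EtaleGroupoid X G) (h : C₀(X, ℂ)) :
    HilbertL2 G →L[ℂ] HilbertL2 G :=
  HilbertL2.diagonal (fun γ => h (𝒢.r γ)) (norm_nonneg h) fun γ => h.toBCF.norm_coe_le_norm (𝒢.r γ)

theorem unitOp_apply (h : C₀(X, ℂ)) (ξ : HilbertL2 G) (γ : G) :
    unitOp 𝒢 h ξ γ = h (𝒢.r γ) * ξ γ := HilbertL2.diagonal_apply _ _ _ _ _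

theorem norm_unitOp_le (𝒢 : EtaleGroupoid X G) (h : C₀(X, ℂ)) : ‖unitOp 𝒢 h‖ ≤ ‖h‖ :=
  HilbertL2.norm_diagonal_le _ _ _

/-- The representation of `C₀(X)` on `ℓ²(G)`. -/
noncomputable def unitOpHom (𝒢 : EtaleGroupoid X G) :
    C₀(X, ℂ) →⋆ₙₐ[ℂ] (HilbertL2 G →L[ℂ] HilbertL2 G) where
  toFun := unitOp 𝒢
  map_smul' z h := ContinuousLinearMap.ext fun ξ => lp.ext <| funext fun γ => by
    change unitOp 𝒢 (z • h) ξ γ = z * unitOp 𝒢 h ξ γ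
    rw [unitOp_apply, unitOp_apply, ← mul_assoc]; rfl
  map_zero' := ContinuousLinearMap.ext fun ξ => lp.ext <| funext fun γ => by
    rw [unitOp_apply]; exact zero_mul _
  map_add' h h' := ContinuousLinearMap.ext fun ξ => lp.ext <| funext fun γ => by
    change unitOp 𝒢 (h + h') ξ γ = unitOp 𝒢 h ξ γ + unitOp 𝒢 h' ξ γ
    rw [unitOp_apply, unitOp_apply, unitOp_apply, ← add_mul]; rfl
  map_mul' h h' := ContinuousLinearMap.ext fun ξ => lp.ext <| funext fun γ => by
    change unitOp 𝒢 (h * h') ξ γ = unitOp 𝒢 h (unitOp 𝒢 h' ξ) γ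
    rw [unitOp_apply, unitOp_apply, unitOp_apply, ← mul_assoc]; rfl
  map_star' h := by
    rw [ContinuousLinearMap.star_eq_adjoint, ContinuousLinearMap.eq_adjoint_iff]
    intro ξ η
    rw [lp.inner_eq_tsum, lp.inner_eq_tsum]
    refine tsum_congr fun γ => ?_
    rw [unitOp_apply, unitOp_apply, RCLike.inner_apply, RCLike.inner_apply, map_mul]
    have : (star h) (𝒢.r γ) = (starRingEnd ℂ) (h (𝒢.r γ)) := rfl
    rw [this, Complex.conj_conj]
    ring

theorem isOpenEmbedding_unit (𝒢 : EtaleGroupoid X G) : IsOpenEmbedding 𝒢.unit := by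
  have h : IsLocalHomeomorph 𝒢.unit := IsLocalHomeomorph.of_comp (g := 𝒢.r) (f := 𝒢.unit)
    (by rw [show 𝒢.r ∘ 𝒢.unit = id from funext 𝒢.r_unit]; exact (Homeomorph.refl X).isLocalHomeomorph)
    𝒢.isLocalHomeomorph_r 𝒢.continuous_unit
  exact h.isOpenEmbedding_of_injective (Function.LeftInverse.injective 𝒢.r_unit)

theorem isOpenEmbedding_ι (T : Twist 𝒢 E) :
    IsOpenEmbedding fun p : X × Circle => T.ι p.1 p.2 := by
  refine ⟨T.isEmbedding_ι, ?_⟩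
  have : (Set.range fun p : X × Circle => T.ι p.1 p.2) = T.q ⁻¹' Set.range 𝒢.unit := by
    ext σ
    simp only [Set.mem_range, Set.mem_preimage, Prod.exists]
    exact exists_congr fun x => ((T.q_eq_unit_iff σ x).symm.trans eq_comm)
  rw [this]
  exact (isOpenEmbedding_unit 𝒢).isOpen_range.preimage T.continuous_q

theorem act_ι (T : Twist 𝒢 E) (w : Circle) (x : X) (z : Circle) :
    T.act w (T.ι x z) = T.ι x (w * z) := by
  rw [← T.ι_mul]
  exact TopGroupoid.mul_congr (by rw [T.r_ι]) rfl _

theorem q_act (T : Twist 𝒢 E) (w : Circle) (σ : E) : T.q (T.act w σ) = T.q σ := by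
  have h : T.q (T.ι (T.grpd.r σ) w) = 𝒢.unit (𝒢.r (T.q σ)) := by
    rw [T.q_eq_unit_iff, T.r_q]; exact ⟨w, rfl⟩
  rw [act, T.q_mul]
  exact (TopGroupoid.mul_congr h rfl _).trans (𝒢.unit_mul _)

theorem t2Space_units [T2Space E] (T : Twist 𝒢 E) : T2Space X :=
  T2Space.of_injective_continuous (Function.LeftInverse.injective T.grpd.r_unit)
    T.grpd.continuous_unit

theorem hasCompactSupport_coe_mul {h : X → ℂ} (hs : HasCompactSupport h) [T2Space X] :
    HasCompactSupport fun p : X × Circle => (p.2 : ℂ) * h p.1 :=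
  HasCompactSupport.of_support_subset_isCompact
    (hs.isCompact.prod (isCompact_univ : IsCompact (Set.univ : Set Circle))) fun _ hp =>
    ⟨subset_tsupport _ (right_ne_zero_of_mul (Function.mem_support.1 hp)), trivial⟩

/-- The function on `Σ` that is `z h(x)` at `ι(x, z)` and zero off the range of `ι`. -/
noncomputable def Cc.ofUnits [T2Space E] (T : Twist 𝒢 E) (h : X → ℂ) (hc : Continuous h)
    (hs : HasCompactSupport h) : T.Cc where
  toFun := Function.extend (fun p : X × Circle => T.ι p.1 p.2) (fun p => p.2 * h p.1) 0
  continuous_toFun := by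
    have := T.t2Space_units
    have hι := T.isOpenEmbedding_ι
    refine continuous_of_tsupport fun σ hσ => ?_
    obtain ⟨p, -, rfl⟩ := (hasCompactSupport_coe_mul hs).tsupport_extend_zero_subset
      hι.continuous hσ
    rw [← hι.continuousAt_iff]
    have key : Function.extend (fun p : X × Circle => T.ι p.1 p.2)
        (fun p => (p.2 : ℂ) * h p.1) 0 ∘ (fun p : X × Circle => T.ι p.1 p.2) =
        fun p => (p.2 : ℂ) * h p.1 := funext fun p => hι.injective.extend_apply _ _ p
    have hcont : Continuous fun p : X × Circle => (p.2 : ℂ) * h p.1 := by fun_prop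
    exact (hcont.congr fun p => (congrFun key p).symm).continuousAt
  hasCompactSupport_toFun := by
    have := T.t2Space_units
    exact (hasCompactSupport_coe_mul hs).extend_zero T.isOpenEmbedding_ι.continuous
  map_act w σ := by
    have hinj := T.isOpenEmbedding_ι.injective
    by_cases hσ : ∃ p : X × Circle, T.ι p.1 p.2 = σ
    · obtain ⟨⟨x, z⟩, rfl⟩ := hσ
      have e1 := hinj.extend_apply (fun p : X × Circle => (p.2 : ℂ) * h p.1) 0 (x, z)
      have e2 := hinj.extend_apply (fun p : X × Circle => (p.2 : ℂ) * h p.1) 0 (x, w * z)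
      simp only at e1 e2 ⊢
      rw [act_ι, e1, e2, Circle.coe_mul, mul_assoc]
    · have hσ' : ¬ ∃ p : X × Circle, T.ι p.1 p.2 = T.act w σ := by
        rintro ⟨⟨x, z⟩, e⟩
        have := (T.q_eq_unit_iff _ x).2 ⟨z, e⟩
        rw [q_act, T.q_eq_unit_iff] at this
        exact hσ ⟨(x, this.choose), this.choose_spec⟩
      rw [Function.extend_apply' _ _ _ hσ, Function.extend_apply' _ _ _ hσ']
      simp

theorem Section.leftRegular_ofUnits [T2Space E] (c : T.Section) (h : C₀(X, ℂ))
    (hs : HasCompactSupport h) :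
    c.leftRegular (Cc.ofUnits T h h.continuous hs) = unitOp 𝒢 h := by
  refine ContinuousLinearMap.ext fun ξ => lp.ext <| funext fun γ => ?_
  rw [c.leftRegular_apply, unitOp_apply, tsum_eq_single γ]
  · congr 1
    unfold Section.matrix
    rw [dif_pos rfl, T.grpd.mul_inv, c.r_eq, ← T.ι_one]
    have := T.isOpenEmbedding_ι.injective.extend_apply
      (fun p : X × Circle => (p.2 : ℂ) * h p.1) 0 (𝒢.r γ, 1)
    exact this.trans (by simp)
  · intro η hη
    have : c.matrix (Cc.ofUnits T h h.continuous hs) γ η = 0 := by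
      unfold Section.matrix
      split_ifs with e
      · refine (Function.extend_apply' (f := fun p : X × Circle => T.ι p.1 p.2)
          (fun p : X × Circle => (p.2 : ℂ) * h p.1) 0 _ ?_)
        rintro ⟨⟨x, z⟩, he⟩
        have hq := (T.q_eq_unit_iff _ x).2 ⟨z, he⟩
        rw [c.q_mul_inv e] at hq
        have hx := congrArg 𝒢.r hq
        rw [𝒢.r_mul, 𝒢.r_unit] at hx
        rw [← hx] at hq
        have := TopGroupoid.inv_eq_of_mul_eq_unit _ hq
        exact hη (TopGroupoid.inv_injective this).symm
      · rfl
    rw [this, zero_mul]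

/-- Functions of compact support are dense in `C₀(X)`. -/
theorem exists_hasCompactSupport_norm_sub_le [T2Space X] (h : C₀(X, ℂ)) {ε : ℝ} (hε : 0 < ε) :
    ∃ k : C₀(X, ℂ), HasCompactSupport k ∧ ‖h - k‖ ≤ ε := by
  obtain ⟨K, hK, hKε⟩ := Filter.mem_cocompact.1
    (h.zero_at_infty'.eventually (Metric.ball_mem_nhds (0 : ℂ) hε))
  have hsmall : ∀ x, x ∉ K → ‖h x‖ < ε := fun x hx => by simpa using hKε hx
  let u : X → ℝ := fun x => max (‖h x‖ - ε) 0 / max ‖h x‖ ε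
  have hpos : ∀ x, 0 < max ‖h x‖ ε := fun x => lt_max_of_lt_right hε
  have hu : Continuous u := Continuous.div (by fun_prop) (by fun_prop) fun x => (hpos x).ne'
  have hu0 : ∀ x, 0 ≤ u x := fun x => div_nonneg (le_max_right _ _) (hpos x).le
  have hsupp : HasCompactSupport fun x => (u x : ℂ) * h x := by
    refine HasCompactSupport.of_support_subset_isCompact hK fun x hx => ?_
    by_contra hxK
    refine hx ?_
    have : u x = 0 := by
      change max (‖h x‖ - ε) 0 / _ = 0
      rw [max_eq_right (by linarith [hsmall x hxK]), zero_div]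
    simp [this]
  let k : C₀(X, ℂ) :=
    { toFun := fun x => (u x : ℂ) * h x
      continuous_toFun := by fun_prop
      zero_at_infty' := hsupp.is_zero_at_infty }
  refine ⟨k, hsupp, ?_⟩
  rw [← ZeroAtInftyContinuousMap.norm_toBCF_eq_norm, BoundedContinuousFunction.norm_le hε.le]
  intro x
  change ‖h x - (u x : ℂ) * h x‖ ≤ ε
  have e : h x - (u x : ℂ) * h x = ((1 - u x : ℝ) : ℂ) * h x := by push_cast; ring
  rw [e, norm_mul, Complex.norm_real, Real.norm_eq_abs]
  by_cases hx : ‖h x‖ ≤ ε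
  · have : u x = 0 := by
      change max (‖h x‖ - ε) 0 / _ = 0
      rw [max_eq_right (by linarith), zero_div]
    simpa [this] using hx
  · push Not at hx
    have h0 : 0 < ‖h x‖ := hε.trans hx
    have : 1 - u x = ε / ‖h x‖ := by
      change 1 - max (‖h x‖ - ε) 0 / max ‖h x‖ ε = _
      rw [max_eq_left (by linarith), max_eq_left hx.le]
      field_simp
      ring
    rw [this, abs_of_pos (by positivity), div_mul_cancel₀ _ h0.ne']

theorem Section.unitOp_mem [T2Space G] [T2Space E] (c : T.Section) (h : C₀(X, ℂ)) :
    unitOpHom 𝒢 h ∈ c.reducedAlgebra := by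
  have : T2Space X := (isOpenEmbedding_unit 𝒢).isEmbedding.t2Space
  have hcl : IsClosed (c.reducedAlgebra : Set (HilbertL2 G →L[ℂ] HilbertL2 G)) :=
    NonUnitalStarSubalgebra.isClosed_topologicalClosure _
  change unitOpHom 𝒢 h ∈ (c.reducedAlgebra : Set (HilbertL2 G →L[ℂ] HilbertL2 G))
  rw [← hcl.closure_eq, Metric.mem_closure_iff]
  intro ε hε
  obtain ⟨k, hk, hle⟩ := exists_hasCompactSupport_norm_sub_le h (half_pos hε)
  refine ⟨unitOpHom 𝒢 k, ?_, ?_⟩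
  · change unitOp 𝒢 k ∈ c.reducedAlgebra
    rw [← c.leftRegular_ofUnits k hk]
    exact c.leftRegular_mem _
  · rw [dist_eq_norm, ← map_sub]
    exact ((norm_unitOp_le 𝒢 (h - k)).trans hle).trans_lt (half_lt_self hε)

/-- The embedding `C₀(G⁽⁰⁾) → C*_r(Σ; G)`. -/
noncomputable def Section.unitHom [T2Space G] [T2Space E] (c : T.Section) :
    C₀(X, ℂ) →⋆ₙₐ[ℂ] c.reducedAlgebra :=
  NonUnitalStarAlgHom.codRestrict (unitOpHom 𝒢) c.reducedAlgebra c.unitOp_mem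

end Twist

/-! ### Regular ideals -/

section RegularIdeals

variable {A : Type*} [NonUnitalRing A] [Module ℂ A] [TopologicalSpace A]

/-- `X^⊥ = {a ∈ A : a x = x a = 0 for all x ∈ X}`. -/
def perp (S : Set A) : Set A := {a | ∀ x ∈ S, a * x = 0 ∧ x * a = 0}

/-- Closed two-sided ideals. -/
def IsClosedIdeal (J : Submodule ℂ A) : Prop :=
  IsClosed (J : Set A) ∧ ∀ a : A, ∀ x ∈ J, a * x ∈ J ∧ x * a ∈ J

/-- Regular ideals: closed two-sided ideals with `J = J^⊥⊥`. -/
def IsRegularIdeal (J : Submodule ℂ A) : Prop :=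
  IsClosedIdeal J ∧ (J : Set A) = perp (perp (J : Set A))

/-- Every nonzero regular ideal of `A` has nonzero intersection with `B`. -/
def HasRegularIdealIntersectionProperty (B : Set A) : Prop :=
  ∀ J : Submodule ℂ A, IsRegularIdeal J → J ≠ ⊥ → ∃ b ∈ B, b ∈ J ∧ b ≠ 0

/-- Regular open sets: `U` is the interior of its closure. -/
def IsRegularOpen {X : Type*} [TopologicalSpace X] (U : Set X) : Prop :=
  interior (closure U) = U

theorem IsRegularOpen.isOpen {X : Type*} [TopologicalSpace X] {U : Set X}
    (hU : IsRegularOpen U) : IsOpen U := by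
  have h : interior (closure U) = U := hU
  exact h ▸ isOpen_interior

end RegularIdeals

/-- The copy of `C*_r(Σ_U; G_U)` in `C*_r(Σ; G)`, the range of the embedding. -/
noncomputable def Twist.Section.openSubalgebra {X G E : Type*} [TopologicalSpace X]
    [TopologicalSpace G] [TopologicalSpace E] [T2Space E] {𝒢 : EtaleGroupoid X G}
    {T : Twist 𝒢 E} (c : T.Section) (U : Set X) (hU : 𝒢.Invariant U) (hop : IsOpen U) :
    NonUnitalStarSubalgebra ℂ c.reducedAlgebra :=
  NonUnitalStarAlgHom.range (c.inclusionHom U hU hop)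

/-!
Write `a γ η` for the matrix entries of an operator `a` on `ℓ²(G)`. Every `a` in `C*_r(Σ; G)` is
left convolution by a continuous equivariant function on `Σ`: the entry `a γ η` is the value of
that function at `c(γ) c(η)⁻¹` (`Twist.Section.exists_isKernel`). For elements of `C_c(Σ; G)` this
is the definition. The property is preserved by uniform limits, and by left convolution with
`f ∈ C_c(Σ; G)`, which is locally a finite sum over slices; hence it holds on the closure of the
algebra that they generate. Consequently `|a γ η|` is a continuous function of `γ η⁻¹`, and the set
`fiberSupport a` of units `x` at which `a` acts nontrivially on `ℓ²(G_x)` is open and invariant.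

Exactness says that the image of `C*_r(Σ_U; G_U)` is `I(U) = {a | fiberSupport a ⊆ U}`
(`Twist.Section.mem_openSubalgebra_iff`). Since fibre supports are open, and since functions in
`C₀(U)` lie in `I(U)`, the annihilator of `I(U)` is `I(V)` for the exterior `V` of `U`
(`Twist.Section.perp_setOf_fiberSupport_subset`). Taking annihilators twice replaces `U` by the
interior of its closure, so `I(U)` is regular when `U` is.

Let `J` be a regular ideal, `V` the union of the fibre supports of its elements and `W` the
interior of the closure of `V`. Then `J ⊆ I(W)`. The ideal `J^⊥ ∩ I(W)` is regular, as the
annihilator of `J ∪ I(W)^⊥`. If it were nonzero it would contain a nonzero `h ∈ C₀(X)`, whose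
support meets `V`, say at `y`. Some `a ∈ J` is nonzero on `ℓ²(G_y)`; left multiplication by a
function in `C_c(Σ; G)` supported on a slice produces an element of `J` with a nonzero entry in the
row of the unit `y`, which `h` does not annihilate, a contradiction. So `J^⊥ I(W) = 0`, that is,
`I(W) ⊆ J^⊥⊥ = J`.
-/

/-! ### Matrix entries of operators on `ℓ²` -/

namespace HilbertL2

variable {I : Type*}

open Classical in
/-- The matrix entry `(a δⱼ)(i)` of an operator `a` on `ℓ²(I)`. -/
noncomputable def entry (a : HilbertL2 I →L[ℂ] HilbertL2 I) (i j : I) : ℂ :=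
  a (lp.single 2 j (1 : ℂ)) i

theorem entry_def [DecidableEq I] (a : HilbertL2 I →L[ℂ] HilbertL2 I) (i j : I) :
    entry a i j = a (lp.single 2 j (1 : ℂ)) i := by
  obtain rfl : ‹DecidableEq I› = fun i j => Classical.propDecidable (i = j) :=
    Subsingleton.elim _ _
  rfl

theorem entry_add (a b : HilbertL2 I →L[ℂ] HilbertL2 I) (i j : I) :
    entry (a + b) i j = entry a i j + entry b i j := rfl

theorem entry_sub (a b : HilbertL2 I →L[ℂ] HilbertL2 I) (i j : I) :
    entry (a - b) i j = entry a i j - entry b i j := rfl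

theorem entry_smul (z : ℂ) (a : HilbertL2 I →L[ℂ] HilbertL2 I) (i j : I) :
    entry (z • a) i j = z * entry a i j := rfl

@[simp]
theorem entry_zero (i j : I) : entry (0 : HilbertL2 I →L[ℂ] HilbertL2 I) i j = 0 := rfl

theorem norm_entry_le (a : HilbertL2 I →L[ℂ] HilbertL2 I) (i j : I) : ‖entry a i j‖ ≤ ‖a‖ := by
  classical
  refine (lp.norm_apply_le_norm (by norm_num) _ i).trans ((a.le_opNorm _).trans ?_)
  rw [lp.norm_single (by norm_num)]
  simp

theorem continuous_entry (i j : I) :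
    Continuous fun a : HilbertL2 I →L[ℂ] HilbertL2 I => entry a i j := by
  classical
  refine continuous_iff_continuousAt.2 fun a => ?_
  rw [Metric.continuousAt_iff]
  refine fun ε hε => ⟨ε, hε, fun {b} hb => ?_⟩
  rw [dist_eq_norm] at hb ⊢
  rw [← entry_sub]
  exact (norm_entry_le _ i j).trans_lt hb

open scoped InnerProductSpace in
theorem apply_eq_tsum_entry (a : HilbertL2 I →L[ℂ] HilbertL2 I) (ξ : HilbertL2 I) (i : I) :
    a ξ i = ∑' j, entry a i j * ξ j := by
  classical
  rw [← inner_single, ← ContinuousLinearMap.adjoint_inner_left, lp.inner_eq_tsum]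
  refine tsum_congr fun j => ?_
  rw [RCLike.inner_apply, mul_comm]
  congr 1
  rw [← inner_single j, ContinuousLinearMap.adjoint_inner_right, inner_conj_symm, inner_single,
    entry_def]

theorem entry_mul (a b : HilbertL2 I →L[ℂ] HilbertL2 I) (i j : I) :
    entry (a * b) i j = ∑' k, entry a i k * entry b k j :=
  apply_eq_tsum_entry a _ i

theorem ext_entry {a b : HilbertL2 I →L[ℂ] HilbertL2 I}
    (h : ∀ i j, entry a i j = entry b i j) : a = b := by
  refine ContinuousLinearMap.ext fun ξ => lp.ext <| funext fun i => ?_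
  rw [apply_eq_tsum_entry, apply_eq_tsum_entry]
  exact tsum_congr fun j => by rw [h]

theorem entry_ofMatrix (K : I → I → ℂ) {n : ℕ} {C : ℝ} (hK : IsBanded K n C) (i j : I) :
    entry (ofMatrix K hK) i j = K i j := by
  classical
  rw [entry_def, ofMatrix_apply, tsum_eq_single j]
  · simp [lp.single_apply]
  · intro k hk
    rw [lp.single_apply, Pi.single_eq_of_ne hk, mul_zero]

theorem entry_compress (S : Set I) (a : HilbertL2 I →L[ℂ] HilbertL2 I) (i j : S) :
    entry (compress S a) i j = entry a i j := by
  classical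
  have h : incl S (lp.single 2 j (1 : ℂ)) = lp.single 2 (j : I) (1 : ℂ) := by
    refine lp.ext <| funext fun k => ?_
    by_cases hk : k ∈ S
    · lift k to S using hk
      rw [incl_apply_mem, lp.single_apply, lp.single_apply]
      simp [Pi.single_apply, Subtype.ext_iff]
    · rw [incl_apply_notMem _ _ hk, lp.single_apply, Pi.single_eq_of_ne]
      rintro rfl
      exact hk j.2
  have e := congrArg (fun ξ : HilbertL2 I => a ξ (i : I)) h
  rw [entry_def, entry_def, compress_apply, res_apply]
  exact e

end HilbertL2

/-! ### The circle action and local sections of a twist -/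

namespace Twist

variable {X G E : Type*} [TopologicalSpace X] [TopologicalSpace G] [TopologicalSpace E]
  {𝒢 : EtaleGroupoid X G} {T : Twist 𝒢 E}

theorem act_mul (z : Circle) (σ τ : E) (H : T.grpd.s (T.act z σ) = T.grpd.r τ) :
    T.grpd.mul (T.act z σ) τ H =
      T.act z (T.grpd.mul σ τ ((T.s_act z σ).symm.trans H)) := by
  unfold act
  rw [T.grpd.mul_assoc]
  exact TopGroupoid.mul_congr (by rw [T.grpd.r_mul]) rfl _

theorem mul_act (z : Circle) (σ τ : E) (H : T.grpd.s σ = T.grpd.r (T.act z τ)) :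
    T.grpd.mul σ (T.act z τ) H =
      T.act z (T.grpd.mul σ τ (H.trans (T.r_act z τ))) := by
  have H' : T.grpd.s σ = T.grpd.r τ := H.trans (T.r_act z τ)
  rw [← T.act_mul z σ τ ((T.s_act z σ).trans H')]
  unfold act
  rw [← T.grpd.mul_assoc σ _ τ (H'.trans (T.r_ι _ _).symm)]
  refine TopGroupoid.mul_congr ?_ rfl _
  rw [T.central]
  exact TopGroupoid.mul_congr rfl (by rw [H']) _

theorem act_act (z w : Circle) (σ : E) : T.act z (T.act w σ) = T.act (z * w) σ := by
  unfold act
  rw [← T.grpd.mul_assoc _ _ _ ((T.s_ι _ z).trans (by rw [T.grpd.r_mul]))]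
  refine TopGroupoid.mul_congr ?_ rfl _
  rw [← T.ι_mul]
  refine TopGroupoid.mul_congr ?_ rfl _
  rw [T.grpd.r_mul, T.r_ι]

theorem one_act (σ : E) : T.act 1 σ = σ := by
  rw [act]
  exact (TopGroupoid.mul_congr (T.ι_one _) rfl _).trans (T.grpd.unit_mul σ)

theorem inv_act (z : Circle) (σ : E) : T.grpd.inv (T.act z σ) = T.act z⁻¹ (T.grpd.inv σ) := by
  refine TopGroupoid.inv_eq_of_mul_eq_unit
    (by rw [T.s_act, T.r_act, T.grpd.r_inv]) ?_
  rw [act_mul, mul_act, act_act, mul_inv_cancel, one_act, T.grpd.mul_inv, T.r_act]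

theorem exists_eq_act {σ τ : E} (h : T.q σ = T.q τ) : ∃ z, σ = T.act z τ := by
  have hs : T.grpd.s σ = T.grpd.s τ := by rw [← T.s_q, h, T.s_q]
  have hr : T.grpd.r σ = T.grpd.r τ := by rw [← T.r_q, h, T.r_q]
  have H : T.grpd.s σ = T.grpd.r (T.grpd.inv τ) := by rw [T.grpd.r_inv, hs]
  have hq : T.q (T.grpd.mul σ (T.grpd.inv τ) H) = 𝒢.unit (T.grpd.r σ) := by
    rw [T.q_mul, ← T.r_q σ]
    exact (TopGroupoid.mul_congr rfl (by rw [T.q_inv, h]) _).trans (𝒢.mul_inv _)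
  obtain ⟨z, hz⟩ := (T.q_eq_unit_iff _ _).1 hq
  refine ⟨z, ?_⟩
  have e := TopGroupoid.mul_inv_cancel σ (T.grpd.inv τ) H
  rw [← e, act]
  exact TopGroupoid.mul_congr (by rw [← hz, hr]) (TopGroupoid.inv_inv τ) _

/-- Near every arrow of `G` the composite `r ∘ q : Σ → X` has a continuous local section. The set
`B` is then a slice on which `r` is injective. -/
theorem exists_section_range (T : Twist 𝒢 E) (γ : G) : ∃ B : Set G, IsOpen B ∧ γ ∈ B ∧
    ∃ t : X → E, ContinuousOn t (𝒢.r '' B) ∧ ∀ β ∈ B, T.q (t (𝒢.r β)) = β := by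
  classical
  obtain ⟨B, hB, hγB, S, hS, hqS⟩ := T.exists_local_section γ
  obtain ⟨e, hγe, he⟩ := 𝒢.isLocalHomeomorph_r γ
  have hmem : ∀ x ∈ 𝒢.r '' (B ∩ e.source), e.symm x ∈ B := by
    rintro _ ⟨β, hβ, rfl⟩
    rw [he, e.left_inv hβ.2]
    exact hβ.1
  refine ⟨B ∩ e.source, hB.inter e.open_source, ⟨hγB, hγe⟩,
    fun x => if h : e.symm x ∈ B then S ⟨e.symm x, h⟩ else S ⟨γ, hγB⟩, ?_, ?_⟩
  · rw [continuousOn_iff_continuous_domRestrict]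
    have hc : ContinuousOn e.symm (𝒢.r '' (B ∩ e.source)) := by
      refine e.continuousOn_symm.mono ?_
      rintro _ ⟨β, hβ, rfl⟩
      rw [he]
      exact e.map_source hβ.2
    have := hS.comp ((continuousOn_iff_continuous_domRestrict.1 hc).subtype_mk
      fun x => hmem x.1 x.2)
    refine this.congr fun x => ?_
    simp [Set.domRestrict, hmem x.1 x.2]
  · intro β hβ
    have e1 : e.symm (𝒢.r β) = β := by rw [he, e.left_inv hβ.2]
    have h : e.symm (𝒢.r β) ∈ B := by rw [e1]; exact hβ.1
    exact (congrArg T.q (dif_pos h)).trans ((hqS _).trans e1)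

theorem Section.entry_leftRegular (c : T.Section) (f : T.Cc) (γ η : G) :
    HilbertL2.entry (c.leftRegular f) γ η = c.matrix f γ η :=
  HilbertL2.entry_ofMatrix _ _ _ _

end Twist

/-! ### Inverses and adjoints -/

namespace TopGroupoid

variable {X G : Type*} [TopologicalSpace X] [TopologicalSpace G] {𝒢 : TopGroupoid X G}

theorem inv_mul_rev (g h : G) (H : 𝒢.s g = 𝒢.r h) :
    𝒢.inv (𝒢.mul g h H) =
      𝒢.mul (𝒢.inv h) (𝒢.inv g) ((𝒢.s_inv h).trans (H.symm.trans (𝒢.r_inv g).symm)) := by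
  have H1 : 𝒢.s (𝒢.mul g h H) = 𝒢.r (𝒢.inv h) := (𝒢.s_mul g h H).trans (𝒢.r_inv h).symm
  have H2 : 𝒢.s (𝒢.inv h) = 𝒢.r (𝒢.inv g) := (𝒢.s_inv h).trans (H.symm.trans (𝒢.r_inv g).symm)
  refine inv_eq_of_mul_eq_unit (H1.trans (𝒢.r_mul _ _ _).symm) ?_
  rw [← 𝒢.mul_assoc _ _ _ H1 H2, 𝒢.r_mul, ← 𝒢.mul_inv]
  exact mul_congr (mul_inv_cancel g h H) rfl _

end TopGroupoid

namespace Twist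

variable {X G E : Type*} [TopologicalSpace X] [TopologicalSpace G] [TopologicalSpace E]
  {𝒢 : EtaleGroupoid X G} {T : Twist 𝒢 E}

/-- The adjoint `f*(σ) = conj f(σ⁻¹)` in `C_c(Σ; G)`. -/
noncomputable def Cc.adjoint (f : T.Cc) : T.Cc where
  toFun σ := (starRingEnd ℂ) (f (T.grpd.inv σ))
  continuous_toFun := Complex.continuous_conj.comp (f.continuous_toFun.comp T.grpd.continuous_inv)
  hasCompactSupport_toFun := by
    let e : E ≃ₜ E :=
      { toFun := T.grpd.inv, invFun := T.grpd.inv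
        left_inv := fun g => TopGroupoid.inv_inv g, right_inv := fun g => TopGroupoid.inv_inv g
        continuous_toFun := T.grpd.continuous_inv, continuous_invFun := T.grpd.continuous_inv }
    exact (f.hasCompactSupport_toFun.comp_homeomorph e).comp_left (map_zero _)
  map_act z σ := by
    rw [inv_act, f.map_act, map_mul, Circle.coe_inv_eq_conj, Complex.conj_conj]

theorem Section.inv_mul_inv (c : T.Section) {γ η : G} (h : 𝒢.s γ = 𝒢.s η) :
    T.grpd.inv (T.grpd.mul (c γ) (T.grpd.inv (c η)) (c.composable h)) =
      T.grpd.mul (c η) (T.grpd.inv (c γ)) (c.composable h.symm) := by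
  rw [TopGroupoid.inv_mul_rev]
  exact TopGroupoid.mul_congr (TopGroupoid.inv_inv _) rfl _

theorem Section.star_leftRegular (c : T.Section) (f : T.Cc) :
    star (c.leftRegular f) = c.leftRegular f.adjoint := by
  classical
  refine HilbertL2.ext_entry fun γ η => ?_
  have e : HilbertL2.entry (star (c.leftRegular f)) γ η =
      (starRingEnd ℂ) (HilbertL2.entry (c.leftRegular f) η γ) := by
    rw [HilbertL2.entry_def, HilbertL2.entry_def, ← HilbertL2.inner_single γ,
      ContinuousLinearMap.star_eq_adjoint, ContinuousLinearMap.adjoint_inner_right,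
      ← HilbertL2.inner_single η, inner_conj_symm]
  rw [e, c.entry_leftRegular, c.entry_leftRegular]
  unfold matrix
  by_cases h : 𝒢.s γ = 𝒢.s η
  · rw [dif_pos h, dif_pos h.symm]
    exact congrArg (fun σ => (starRingEnd ℂ) (f σ)) (c.inv_mul_inv h).symm
  · rw [dif_neg h, dif_neg (Ne.symm h), map_zero]

/-! ### Convolution kernels -/

/-- The operator `a` on `ℓ²(G)` is left convolution by the continuous equivariant function `k`
on `Σ`. -/
structure Section.IsKernel (c : T.Section) (a : HilbertL2 G →L[ℂ] HilbertL2 G) (k : E → ℂ) :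
    Prop where
  continuous : Continuous k
  map_act : ∀ (z : Circle) (σ : E), k (T.act z σ) = z * k σ
  entry_eq : ∀ (γ η : G) (h : 𝒢.s γ = 𝒢.s η),
    HilbertL2.entry a γ η = k (T.grpd.mul (c γ) (T.grpd.inv (c η)) (c.composable h))
  entry_eq_zero : ∀ γ η : G, 𝒢.s γ ≠ 𝒢.s η → HilbertL2.entry a γ η = 0

theorem Section.isKernel_leftRegular (c : T.Section) (f : T.Cc) :
    c.IsKernel (c.leftRegular f) f where
  continuous := f.continuous_toFun
  map_act := f.map_act
  entry_eq γ η h := by rw [c.entry_leftRegular, matrix, dif_pos h]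
  entry_eq_zero γ η h := by rw [c.entry_leftRegular, matrix, dif_neg h]

theorem Section.isKernel_zero (c : T.Section) : c.IsKernel 0 0 where
  continuous := continuous_zero
  map_act := by simp
  entry_eq := by simp
  entry_eq_zero := by simp

theorem Section.IsKernel.add {c : T.Section} {a b : HilbertL2 G →L[ℂ] HilbertL2 G} {k l : E → ℂ}
    (ha : c.IsKernel a k) (hb : c.IsKernel b l) : c.IsKernel (a + b) (k + l) where
  continuous := ha.continuous.add hb.continuous
  map_act z σ := by simp only [Pi.add_apply, ha.map_act, hb.map_act, mul_add]
  entry_eq γ η h := by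
    rw [HilbertL2.entry_add, ha.entry_eq γ η h, hb.entry_eq γ η h, Pi.add_apply]
  entry_eq_zero γ η h := by
    rw [HilbertL2.entry_add, ha.entry_eq_zero γ η h, hb.entry_eq_zero γ η h, add_zero]

theorem Section.IsKernel.smul {c : T.Section} {a : HilbertL2 G →L[ℂ] HilbertL2 G} {k : E → ℂ}
    (ha : c.IsKernel a k) (w : ℂ) : c.IsKernel (w • a) (w • k) where
  continuous := ha.continuous.const_smul w
  map_act z σ := by simp only [Pi.smul_apply, ha.map_act, smul_eq_mul]; ring
  entry_eq γ η h := by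
    rw [HilbertL2.entry_smul, ha.entry_eq γ η h, Pi.smul_apply, smul_eq_mul]
  entry_eq_zero γ η h := by rw [HilbertL2.entry_smul, ha.entry_eq_zero γ η h, mul_zero]

/-- Every `σ` is, up to the circle action, of the form `c(γ) c(η)⁻¹`. -/
theorem Section.exists_eq_act_mul_inv (c : T.Section) (σ : E) :
    ∃ (z : Circle) (γ η : G) (h : 𝒢.s γ = 𝒢.s η),
      σ = T.act z (T.grpd.mul (c γ) (T.grpd.inv (c η)) (c.composable h)) := by
  have h : 𝒢.s (T.q σ) = 𝒢.s (𝒢.unit (𝒢.s (T.q σ))) := (𝒢.s_unit _).symm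
  obtain ⟨z, hz⟩ := T.exists_eq_act (σ := σ)
    (τ := T.grpd.mul (c (T.q σ)) (T.grpd.inv (c (𝒢.unit (𝒢.s (T.q σ))))) (c.composable h)) (by
      rw [c.q_mul_inv h]
      have e : 𝒢.inv (𝒢.unit (𝒢.s (T.q σ))) = 𝒢.unit (𝒢.s (T.q σ)) := by
        refine TopGroupoid.inv_eq_of_mul_eq_unit (by rw [𝒢.s_unit, 𝒢.r_unit]) ?_
        have := 𝒢.unit_mul (𝒢.unit (𝒢.s (T.q σ)))
        rw [TopGroupoid.mul_congr (congrArg 𝒢.unit (𝒢.r_unit _)) rfl] at this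
        rw [this, 𝒢.r_unit]
      exact ((TopGroupoid.mul_congr rfl e _).trans (𝒢.mul_unit _)).symm)
  exact ⟨z, _, _, h, hz⟩

/-- Kernels depend uniformly continuously on the operator, so the operators with a kernel form a
closed set. -/
theorem Section.exists_isKernel_of_mem_closure (c : T.Section)
    {a : HilbertL2 G →L[ℂ] HilbertL2 G} (ha : a ∈ closure {b | ∃ k, c.IsKernel b k}) :
    ∃ k, c.IsKernel a k := by
  choose z γ η h hσ using c.exists_eq_act_mul_inv
  -- equivariance forces this formula, and it is the uniform limit of the approximating kernels
  set k : E → ℂ := fun σ => z σ * HilbertL2.entry a (γ σ) (η σ)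
  have happ : ∀ ε > 0, ∃ b l, c.IsKernel b l ∧ ‖a - b‖ < ε ∧ ∀ σ, ‖k σ - l σ‖ < ε := by
    intro ε hε
    obtain ⟨b, ⟨l, hl⟩, hb⟩ := Metric.mem_closure_iff.1 ha ε hε
    rw [dist_eq_norm] at hb
    refine ⟨b, l, hl, hb, fun σ => ?_⟩
    have e : l σ = z σ * HilbertL2.entry b (γ σ) (η σ) := by
      conv_lhs => rw [hσ σ]
      rw [hl.map_act, hl.entry_eq _ _ (h σ)]
    rw [e, ← mul_sub, norm_mul, Circle.norm_coe, one_mul, ← HilbertL2.entry_sub]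
    exact (HilbertL2.norm_entry_le _ _ _).trans_lt hb
  have heq : ∀ u v : ℂ, (∀ ε > 0, ‖u - v‖ < ε + ε) → u = v := fun u v huv => by
    refine sub_eq_zero.1 (norm_le_zero_iff.1 (le_of_forall_pos_lt_add fun ε hε => ?_))
    simpa using huv (ε / 2) (half_pos hε)
  refine ⟨k, ?_, fun w σ => heq _ _ fun ε hε => ?_, fun γ' η' h' => heq _ _ fun ε hε => ?_,
    fun γ' η' h' => heq _ _ fun ε hε => ?_⟩
  · refine continuous_of_uniform_approx_of_continuous fun u hu => ?_
    obtain ⟨ε, hε, hεu⟩ := Metric.mem_uniformity_dist.1 hu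
    obtain ⟨b, l, hl, -, hkl⟩ := happ ε hε
    exact ⟨l, hl.continuous, fun σ => hεu (by rw [dist_eq_norm]; exact hkl σ)⟩
  · obtain ⟨b, l, hl, -, hkl⟩ := happ ε hε
    have e : k (T.act w σ) - w * k σ = (k (T.act w σ) - l (T.act w σ)) + w * (l σ - k σ) := by
      rw [hl.map_act]; ring
    rw [e]
    refine (norm_add_le _ _).trans_lt (add_lt_add (hkl _) ?_)
    rw [norm_mul, Circle.norm_coe, one_mul, norm_sub_rev]
    exact hkl σ
  · obtain ⟨b, l, hl, hb, hkl⟩ := happ ε hε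
    rw [← sub_add_sub_cancel _ (HilbertL2.entry b γ' η') _]
    refine (norm_add_le _ _).trans_lt (add_lt_add ?_ ?_)
    · rw [← HilbertL2.entry_sub]
      exact (HilbertL2.norm_entry_le _ _ _).trans_lt hb
    · rw [hl.entry_eq γ' η' h', norm_sub_rev]
      exact hkl _
  · obtain ⟨b, l, hl, hb, -⟩ := happ ε hε
    rw [← hl.entry_eq_zero γ' η' h', ← HilbertL2.entry_sub]
    exact (HilbertL2.norm_entry_le _ _ _).trans_lt (by linarith)

/-! ### Convolution by a compactly supported function -/

open Classical in
/-- The summand `f(τ) k(τ⁻¹ σ)` of the convolution `(f * k)(σ)`; zero unless `r(τ) = r(σ)`. -/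
noncomputable def convTerm (T : Twist 𝒢 E) (f k : E → ℂ) (σ τ : E) : ℂ :=
  if h : T.grpd.r τ = T.grpd.r σ then
    f τ * k (T.grpd.mul (T.grpd.inv τ) σ ((T.grpd.s_inv τ).trans h))
  else 0

/-- The summand depends on `τ` only through `q(τ)`. -/
theorem convTerm_congr {f k : E → ℂ} (hf : ∀ (z : Circle) σ, f (T.act z σ) = z * f σ)
    (hk : ∀ (z : Circle) σ, k (T.act z σ) = z * k σ) (σ : E) {τ τ' : E} (h : T.q τ = T.q τ') :
    T.convTerm f k σ τ = T.convTerm f k σ τ' := by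
  obtain ⟨z, rfl⟩ := T.exists_eq_act h
  unfold convTerm
  by_cases hr : T.grpd.r τ' = T.grpd.r σ
  · have hr' : T.grpd.r (T.act z τ') = T.grpd.r σ := (T.r_act z τ').trans hr
    rw [dif_pos hr, dif_pos hr', hf]
    have e : T.grpd.mul (T.grpd.inv (T.act z τ')) σ ((T.grpd.s_inv _).trans hr') =
        T.act z⁻¹ (T.grpd.mul (T.grpd.inv τ') σ ((T.grpd.s_inv τ').trans hr)) := by
      rw [← T.act_mul z⁻¹ (T.grpd.inv τ') σ
        ((T.s_act _ _).trans ((T.grpd.s_inv τ').trans hr))]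
      exact TopGroupoid.mul_congr (T.inv_act z τ') rfl _
    have hz : (z : ℂ) ≠ 0 := z.coe_ne_zero
    rw [e, hk, Circle.coe_inv]
    field_simp
  · rw [dif_neg hr, dif_neg (by rwa [T.r_act])]

theorem convTerm_act {f k : E → ℂ} (hk : ∀ (z : Circle) σ, k (T.act z σ) = z * k σ) (z : Circle)
    (σ τ : E) : T.convTerm f k (T.act z σ) τ = z * T.convTerm f k σ τ := by
  unfold convTerm
  by_cases hr : T.grpd.r τ = T.grpd.r σ
  · rw [dif_pos hr, dif_pos (hr.trans (T.r_act z σ).symm), mul_act, hk]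
    ring
  · rw [dif_neg hr, dif_neg (by rwa [T.r_act]), mul_zero]

/-- The convolution `(f * k)(σ) = ∑_{r(γ) = r(σ)} f(c(γ)) k(c(γ)⁻¹ σ)`. -/
noncomputable def Section.conv (c : T.Section) (f k : E → ℂ) (σ : E) : ℂ :=
  ∑' γ, T.convTerm f k σ (c γ)

theorem continuousOn_convTerm {f k : E → ℂ} (hf : Continuous f) (hk : Continuous k) {W : Set X}
    {t : X → E} (ht : ContinuousOn t W) (hr : ∀ x ∈ W, T.grpd.r (t x) = x) :
    ContinuousOn (fun σ => T.convTerm f k σ (t (T.grpd.r σ))) (T.grpd.r ⁻¹' W) := by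
  have ht' : ContinuousOn (fun σ => t (T.grpd.r σ)) (T.grpd.r ⁻¹' W) :=
    ht.comp T.grpd.continuous_r.continuousOn fun σ hσ => hσ
  rw [continuousOn_iff_continuous_domRestrict] at ht' ⊢
  have h1 : Continuous fun σ : ↥(T.grpd.r ⁻¹' W) => t (T.grpd.r σ) := ht'
  have H : ∀ σ : ↥(T.grpd.r ⁻¹' W),
      T.grpd.s (T.grpd.inv (t (T.grpd.r σ))) = T.grpd.r (σ : E) := fun σ =>
    (T.grpd.s_inv _).trans (hr _ σ.2)
  have h2 : Continuous fun σ : ↥(T.grpd.r ⁻¹' W) =>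
      T.grpd.mul (T.grpd.inv (t (T.grpd.r σ))) σ (H σ) :=
    T.grpd.continuous_mul.comp
      (Continuous.subtype_mk (p := fun p : E × E => T.grpd.s p.1 = T.grpd.r p.2)
        ((T.grpd.continuous_inv.comp h1).prodMk continuous_subtype_val) H)
  refine ((hf.comp h1).mul (hk.comp h2)).congr fun σ => ?_
  simp [Set.domRestrict, convTerm, hr _ σ.2]

/-- Near any `σ₀` only finitely many slices meet the support of `f`, and the convolution is a
finite sum of continuous functions. -/
theorem Section.continuous_conv [T2Space G] (c : T.Section) (f : T.Cc) {k : E → ℂ}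
    (hk : Continuous k) (hka : ∀ (z : Circle) σ, k (T.act z σ) = z * k σ) :
    Continuous (c.conv f k) := by
  classical
  have : T2Space X := (isOpenEmbedding_unit 𝒢).isEmbedding.t2Space
  refine continuous_iff_continuousAt.2 fun σ₀ => ?_
  set x₀ := T.grpd.r σ₀
  choose B hBo hγB t ht hqt using T.exists_section_range
  set K : Set G := T.q '' tsupport f
  have hK : IsCompact K := f.hasCompactSupport_toFun.isCompact.image T.continuous_q
  have hfin : (K ∩ 𝒢.r ⁻¹' {x₀}).Finite := by
    obtain ⟨S, hS⟩ := hK.elim_finite_subcover B hBo fun γ _ => Set.mem_iUnion.2 ⟨γ, hγB γ⟩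
    refine (S.image fun γ => T.q (t γ x₀)).finite_toSet.subset ?_
    rintro β ⟨hβ, hβx⟩
    obtain ⟨γ, hγ, hβγ⟩ := Set.mem_iUnion₂.1 (hS hβ)
    have hβx : 𝒢.r β = x₀ := hβx
    rw [Finset.mem_coe, Finset.mem_image]
    exact ⟨γ, hγ, by rw [← hβx]; exact hqt γ β hβγ⟩
  obtain ⟨U, hU, hdisj⟩ := hfin.t2_separation
  set D := hfin.toFinset
  have hDmem : ∀ γ, γ ∈ D ↔ γ ∈ K ∧ 𝒢.r γ = x₀ := fun γ => hfin.mem_toFinset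
  set B' : G → Set G := fun γ => B γ ∩ U γ
  have hB'o : ∀ γ, IsOpen (B' γ) := fun γ => (hBo γ).inter (hU γ).2
  have hrB' : ∀ γ, IsOpen (𝒢.r '' B' γ) := fun γ =>
    𝒢.isLocalHomeomorph_r.isOpenMap _ (hB'o γ)
  set K' : Set G := K \ ⋃ γ ∈ D, B' γ
  have hK' : IsClosed (𝒢.r '' K') :=
    ((hK.diff (isOpen_biUnion fun γ _ => hB'o γ)).image 𝒢.continuous_r).isClosed
  set N : Set X := (𝒢.r '' K')ᶜ ∩ ⋂ γ ∈ D, 𝒢.r '' B' γ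
  have hN : IsOpen N := hK'.isOpen_compl.inter (isOpen_biInter_finset fun γ _ => hrB' γ)
  have hx₀ : x₀ ∈ N := by
    refine ⟨?_, Set.mem_iInter₂.2 fun γ hγ => ⟨γ, ⟨hγB γ, (hU γ).1⟩, ((hDmem γ).1 hγ).2⟩⟩
    rintro ⟨γ, ⟨hγ, hγ'⟩, hr⟩
    exact hγ' (Set.mem_iUnion₂.2 ⟨γ, (hDmem γ).2 ⟨hγ, hr⟩, hγB γ, (hU γ).1⟩)
  have hqt' : ∀ γ, ∀ x ∈ 𝒢.r '' B' γ, T.q (t γ x) ∈ B' γ ∧ T.grpd.r (t γ x) = x := by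
    rintro γ _ ⟨β, hβ, rfl⟩
    rw [← T.r_q, hqt γ β hβ.1]
    exact ⟨hβ, rfl⟩
  have hsum : ∀ σ, T.grpd.r σ ∈ N →
      c.conv f k σ = ∑ γ ∈ D, T.convTerm f k σ (t γ (T.grpd.r σ)) := by
    intro σ hσ
    have hmem : ∀ γ ∈ D, T.grpd.r σ ∈ 𝒢.r '' B' γ := Set.mem_iInter₂.1 hσ.2
    have h1 : c.conv f k σ =
        ∑ β ∈ D.image (fun γ => T.q (t γ (T.grpd.r σ))), T.convTerm f k σ (c β) := by
      refine tsum_eq_sum fun β hβ => ?_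
      unfold convTerm
      split_ifs with hr
      · have hr' : 𝒢.r β = T.grpd.r σ := (c.r_eq β).symm.trans hr
        by_cases hf : f (c β) = 0
        · rw [hf, zero_mul]
        · exfalso
          have hβK : β ∈ K := ⟨c β, subset_tsupport _ hf, c.q_toFun β⟩
          have hβU : β ∈ ⋃ γ ∈ D, B' γ := by
            by_contra hn
            exact hσ.1 ⟨β, ⟨hβK, hn⟩, hr'⟩
          obtain ⟨γ, hγ, hβγ⟩ := Set.mem_iUnion₂.1 hβU
          exact hβ (Finset.mem_image.2 ⟨γ, hγ, by rw [← hr']; exact hqt γ β hβγ.1⟩)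
      · rfl
    rw [h1, Finset.sum_image]
    · exact Finset.sum_congr rfl fun γ _ => convTerm_congr f.map_act hka σ (c.q_toFun _)
    · intro γ hγ γ' hγ' e
      by_contra hne
      refine Set.disjoint_left.1 (hdisj (hfin.mem_toFinset.1 hγ) (hfin.mem_toFinset.1 hγ') hne)
        (hqt' γ _ (hmem γ hγ)).1.2 ?_
      have e' : T.q (t γ (T.grpd.r σ)) = T.q (t γ' (T.grpd.r σ)) := e
      rw [e']
      exact (hqt' γ' _ (hmem γ' hγ')).1.2
  have hcont : ContinuousOn (fun σ => ∑ γ ∈ D, T.convTerm f k σ (t γ (T.grpd.r σ)))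
      (T.grpd.r ⁻¹' N) := by
    refine continuousOn_finsetSum _ fun γ hγ => ?_
    refine (continuousOn_convTerm f.continuous_toFun hk ((ht γ).mono ?_)
      fun x hx => (hqt' γ x hx).2).mono fun σ hσ => (Set.mem_iInter₂.1 hσ.2 γ hγ :)
    exact Set.image_mono Set.inter_subset_left
  exact (hcont.congr hsum).continuousAt ((hN.preimage T.grpd.continuous_r).mem_nhds hx₀)

theorem Section.IsKernel.leftRegular_mul [T2Space G] {c : T.Section}
    {a : HilbertL2 G →L[ℂ] HilbertL2 G} {k : E → ℂ} (ha : c.IsKernel a k) (f : T.Cc) :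
    c.IsKernel (c.leftRegular f * a) (c.conv f k) where
  continuous := c.continuous_conv f ha.continuous ha.map_act
  map_act z σ := by
    rw [Section.conv, Section.conv, ← tsum_mul_left]
    exact tsum_congr fun γ => convTerm_act ha.map_act z σ _
  entry_eq γ η h := by
    classical
    rw [HilbertL2.entry_mul]
    set σ := T.grpd.mul (c γ) (T.grpd.inv (c η)) (c.composable h) with hσ
    have hrσ : T.grpd.r σ = 𝒢.r γ := (T.grpd.r_mul _ _ _).trans (c.r_eq γ)
    have hne : ∀ ζ, HilbertL2.entry (c.leftRegular f) γ ζ * HilbertL2.entry a ζ η ≠ 0 →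
        𝒢.s γ = 𝒢.s ζ := fun ζ hζ => by
      by_contra hs
      exact hζ (by rw [c.entry_leftRegular, c.matrix_eq_zero f hs, zero_mul])
    -- the substitution `β = γ ζ⁻¹`
    have hterm : ∀ ζ (hs : 𝒢.s γ = 𝒢.s ζ),
        T.convTerm f k σ (c (𝒢.mul γ (𝒢.inv ζ) (hs.trans (𝒢.r_inv ζ).symm))) =
          HilbertL2.entry (c.leftRegular f) γ ζ * HilbertL2.entry a ζ η := by
      intro ζ hs
      rw [convTerm_congr f.map_act ha.map_act σ
        (τ' := T.grpd.mul (c γ) (T.grpd.inv (c ζ)) (c.composable hs))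
        ((c.q_toFun _).trans (c.q_mul_inv hs).symm), convTerm,
        dif_pos ((T.grpd.r_mul _ _ _).trans (T.grpd.r_mul _ _ _).symm),
        ha.entry_eq ζ η (hs.symm.trans h), c.entry_leftRegular, matrix, dif_pos hs]
      congr 2
      have e1 := TopGroupoid.mul_inv_cancel (𝒢 := T.grpd) (c ζ) (T.grpd.inv (c γ))
        (c.composable hs.symm)
      rw [TopGroupoid.mul_congr rfl (TopGroupoid.inv_inv _)] at e1
      rw [TopGroupoid.mul_congr (c.inv_mul_inv hs) hσ, ← T.grpd.mul_assoc _ _ _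
        ((T.grpd.s_mul _ _ _).trans (T.grpd.s_inv _)) (c.composable h)]
      exact TopGroupoid.mul_congr e1 rfl _
    refine (tsum_eq_tsum_of_ne_zero_bij (fun ζ : Function.support fun ζ =>
      HilbertL2.entry (c.leftRegular f) γ ζ * HilbertL2.entry a ζ η =>
      𝒢.mul γ (𝒢.inv ζ) ((hne ζ ζ.2).trans (𝒢.r_inv _).symm)) ?_ ?_ ?_).symm
    · intro ζ ζ' e
      exact Subtype.ext (TopGroupoid.inv_injective (TopGroupoid.mul_left_cancel e))
    · intro β hβ
      have hr : 𝒢.r β = 𝒢.r γ := by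
        by_contra hr
        exact hβ (dif_neg (by rwa [c.r_eq, hrσ]))
      have H : 𝒢.s (𝒢.inv β) = 𝒢.r γ := (𝒢.s_inv β).trans hr
      have hs : 𝒢.s γ = 𝒢.s (𝒢.mul (𝒢.inv β) γ H) := (𝒢.s_mul _ _ _).symm
      have e : 𝒢.mul γ (𝒢.inv (𝒢.mul (𝒢.inv β) γ H)) (hs.trans (𝒢.r_inv _).symm) = β := by
        have e1 := TopGroupoid.inv_mul_cancel (𝒢 := 𝒢.toTopGroupoid) (𝒢.inv γ) β
          ((𝒢.s_inv γ).trans hr.symm)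
        refine (TopGroupoid.mul_congr (TopGroupoid.inv_inv γ).symm ?_ _).trans e1
        rw [TopGroupoid.inv_mul_rev]
        exact TopGroupoid.mul_congr rfl (TopGroupoid.inv_inv β) _
      have hβ' := hterm _ hs
      rw [e] at hβ'
      exact ⟨⟨_, fun h0 => hβ (hβ'.trans h0)⟩, e⟩
    · exact fun ζ => hterm ζ (hne ζ ζ.2)
  entry_eq_zero γ η h := by
    rw [HilbertL2.entry_mul]
    refine (tsum_congr fun ζ => ?_).trans tsum_zero
    by_cases hs : 𝒢.s γ = 𝒢.s ζ
    · rw [ha.entry_eq_zero ζ η (hs ▸ h), mul_zero]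
    · rw [c.entry_leftRegular, c.matrix_eq_zero f hs, zero_mul]

/-- Every element of `C*_r(Σ; G)` is left convolution by a continuous equivariant function. -/
theorem Section.exists_isKernel [T2Space G] (c : T.Section) {a : HilbertL2 G →L[ℂ] HilbertL2 G}
    (ha : a ∈ c.reducedAlgebra) : ∃ k, c.IsKernel a k := by
  refine c.exists_isKernel_of_mem_closure (closure_mono ?_ ha)
  intro b hb
  have hs : Set.range c.leftRegular ∪ star (Set.range c.leftRegular) =
      Set.range c.leftRegular := by
    refine Set.union_eq_left.2 ?_
    rintro b ⟨f, hf⟩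
    exact ⟨f.adjoint, by rw [← c.star_leftRegular, hf, star_star]⟩
  have hb' : b ∈ NonUnitalAlgebra.adjoin ℂ (Set.range c.leftRegular) := by
    rw [← hs]; exact hb
  -- left multiplication by `b` is carried along to deal with products
  suffices (∃ k, c.IsKernel b k) ∧
      ∀ a, (∃ k, c.IsKernel a k) → ∃ k, c.IsKernel (b * a) k from this.1
  clear hb
  induction hb' using NonUnitalAlgebra.adjoin_induction with
  | mem b hb =>
    obtain ⟨f, rfl⟩ := hb
    exact ⟨⟨_, c.isKernel_leftRegular f⟩, fun a ⟨k, hk⟩ => ⟨_, hk.leftRegular_mul f⟩⟩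
  | add a b _ _ iha ihb =>
    refine ⟨?_, fun d hd => ?_⟩
    · obtain ⟨⟨k, hk⟩, -⟩ := iha
      obtain ⟨⟨l, hl⟩, -⟩ := ihb
      exact ⟨_, hk.add hl⟩
    · obtain ⟨k, hk⟩ := iha.2 d hd
      obtain ⟨l, hl⟩ := ihb.2 d hd
      exact ⟨_, by rw [add_mul]; exact hk.add hl⟩
  | zero => exact ⟨⟨_, c.isKernel_zero⟩, fun d _ => ⟨_, by rw [zero_mul]; exact c.isKernel_zero⟩⟩
  | mul a b _ _ iha ihb =>
    exact ⟨iha.2 b ihb.1, fun d hd => by rw [mul_assoc]; exact iha.2 _ (ihb.2 d hd)⟩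
  | smul w a _ iha =>
    refine ⟨?_, fun d hd => ?_⟩
    · obtain ⟨⟨k, hk⟩, -⟩ := iha
      exact ⟨_, hk.smul w⟩
    · obtain ⟨k, hk⟩ := iha.2 d hd
      exact ⟨_, by rw [smul_mul_assoc]; exact hk.smul w⟩

end Twist

/-! ### Functions supported on a slice -/

namespace Twist

variable {X G E : Type*} [TopologicalSpace X] [TopologicalSpace G] [TopologicalSpace E]
  {𝒢 : EtaleGroupoid X G} {T : Twist 𝒢 E}

theorem continuous_act (T : Twist 𝒢 E) : Continuous fun p : Circle × E => T.act p.1 p.2 :=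
  T.grpd.continuous_mul.comp
    (Continuous.subtype_mk (p := fun p : E × E => T.grpd.s p.1 = T.grpd.r p.2)
      (f := fun p : Circle × E => (T.ι (T.grpd.r p.2) p.1, p.2))
      ((T.isEmbedding_ι.continuous.comp
        ((T.grpd.continuous_r.comp continuous_snd).prodMk continuous_fst)).prodMk continuous_snd)
      fun _ => T.s_ι _ _)

theorem act_left_injective {z w : Circle} {σ : E} (h : T.act z σ = T.act w σ) : z = w :=
  congrArg Prod.snd (T.isEmbedding_ι.injective (a₁ := (T.grpd.r σ, z)) (a₂ := (T.grpd.r σ, w))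
    (TopGroupoid.mul_right_cancel h))

/-- Through every arrow there is a function in `C_c(Σ; G)` that is nonzero there and is supported
on a slice for `r`. In a local trivialization over a slice it is `z φ` for a bump function `φ`. -/
theorem exists_cc_slice [T2Space G] [LocallyCompactSpace G] [T2Space E] (T : Twist 𝒢 E)
    (α : G) : ∃ f : T.Cc, (∀ σ, T.q σ = α → f σ ≠ 0) ∧
      ∀ σ, f σ ≠ 0 → T.grpd.r σ = 𝒢.r α → T.q σ = α := by
  obtain ⟨B, hB, hαB, t, ht, hqt⟩ := T.exists_section_range α
  obtain ⟨L, hL, hαL, hLB⟩ := exists_compact_subset hB hαB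
  obtain ⟨φ, hφα, hφ0, hφc, -⟩ := exists_continuous_one_zero_of_isCompact (isCompact_singleton
    (x := α)) isOpen_interior.isClosed_compl
    (Set.disjoint_left.2 fun β hβ hβ' => hβ' (by rw [hβ]; exact hαL))
  have hφB : tsupport φ ⊆ B := by
    refine (closure_minimal (fun β hβ => ?_) hL.isClosed).trans hLB
    by_contra hβL
    exact hβ (hφ0 fun hβ' => hβL (interior_subset hβ'))
  have hφB' : ∀ β, β ∉ B → φ β = 0 := fun β hβ => image_eq_zero_of_notMem_tsupport
    fun h => hβ (hφB h)
  have hex : ∀ σ, ∃ z, T.q σ ∈ B → σ = T.act z (t (T.grpd.r σ)) := by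
    intro σ
    by_cases hσ : T.q σ ∈ B
    · obtain ⟨z, hz⟩ := T.exists_eq_act (σ := σ) (τ := t (T.grpd.r σ))
        (by rw [← T.r_q, hqt _ hσ])
      exact ⟨z, fun _ => hz⟩
    · exact ⟨1, fun h => absurd h hσ⟩
  choose ζ hζ using hex
  have hrt : ∀ σ, T.q σ ∈ B → T.grpd.r (t (T.grpd.r σ)) = T.grpd.r σ := fun σ hσ => by
    rw [← T.r_q, ← T.r_q σ, hqt _ hσ]
  have hst : ∀ σ, T.q σ ∈ B → T.grpd.s (t (T.grpd.r σ)) = T.grpd.s σ := fun σ hσ => by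
    rw [← T.s_q, ← T.r_q σ, hqt _ hσ, T.s_q]
  -- the trivialization is continuous because `ι` is an embedding and `ι(r(σ), ζ(σ)) = σ t(r(σ))⁻¹`
  have hζc : ContinuousOn ζ (T.q ⁻¹' B) := by
    rw [continuousOn_iff_continuous_domRestrict]
    have h1 : Continuous fun σ : ↥(T.q ⁻¹' B) => t (T.grpd.r σ) := by
      rw [continuousOn_iff_continuous_domRestrict] at ht
      exact ht.comp ((T.grpd.continuous_r.comp continuous_subtype_val).subtype_mk
        fun σ => ⟨T.q σ, σ.2, T.r_q _⟩)
    have H : ∀ σ : ↥(T.q ⁻¹' B), T.grpd.s (σ : E) = T.grpd.r (T.grpd.inv (t (T.grpd.r σ))) :=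
      fun σ => by rw [T.grpd.r_inv, hst _ σ.2]
    have h2 : Continuous fun σ : ↥(T.q ⁻¹' B) =>
        T.grpd.mul σ (T.grpd.inv (t (T.grpd.r σ))) (H σ) :=
      T.grpd.continuous_mul.comp
        (Continuous.subtype_mk (p := fun p : E × E => T.grpd.s p.1 = T.grpd.r p.2)
          (continuous_subtype_val.prodMk (T.grpd.continuous_inv.comp h1)) H)
    have h3 : Continuous fun σ : ↥(T.q ⁻¹' B) => (T.grpd.r (σ : E), ζ σ) := by
      rw [T.isEmbedding_ι.continuous_iff]
      refine h2.congr fun σ => ?_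
      have e := TopGroupoid.mul_inv_cancel (𝒢 := T.grpd)
        (T.ι (T.grpd.r (t (T.grpd.r (σ : E)))) (ζ σ)) (t (T.grpd.r (σ : E))) (T.s_ι _ _)
      refine (TopGroupoid.mul_congr (hζ _ σ.2) rfl _).trans (e.trans ?_)
      rw [hrt _ σ.2]
      rfl
    exact continuous_snd.comp h3
  refine ⟨⟨fun σ => ζ σ * φ (T.q σ), ?_, ?_, ?_⟩, ?_, ?_⟩
  · refine continuous_iff_continuousAt.2 fun σ => ?_
    by_cases hσ : T.q σ ∈ B
    · have h1 : ContinuousAt ζ σ := hζc.continuousAt ((hB.preimage T.continuous_q).mem_nhds hσ)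
      have h2 : Continuous fun σ => (φ (T.q σ) : ℂ) :=
        Complex.continuous_ofReal.comp (φ.continuous.comp T.continuous_q)
      exact (continuous_subtype_val.continuousAt.comp h1).mul h2.continuousAt
    · have hmem : (T.q ⁻¹' tsupport φ)ᶜ ∈ 𝓝 σ :=
        ((isClosed_tsupport φ).preimage T.continuous_q).isOpen_compl.mem_nhds
          fun h => hσ (hφB h)
      refine (continuousAt_const (y := (0 : ℂ))).congr ?_
      filter_upwards [hmem] with τ hτ
      rw [image_eq_zero_of_notMem_tsupport hτ, Complex.ofReal_zero, mul_zero]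
  · have hc : ContinuousOn (fun p : Circle × G => T.act p.1 (t (𝒢.r p.2)))
        (Set.univ ×ˢ tsupport φ) := by
      refine T.continuous_act.comp_continuousOn (continuous_fst.continuousOn.prodMk ?_)
      refine ht.comp (𝒢.continuous_r.comp continuous_snd).continuousOn ?_
      exact fun p hp => ⟨p.2, hφB hp.2, rfl⟩
    refine HasCompactSupport.of_support_subset_isCompact
      ((isCompact_univ.prod hφc.isCompact).image_of_continuousOn hc) fun σ hσ => ?_
    have hφσ : φ (T.q σ) ≠ 0 := fun h => hσ (by simp [h])
    have hσB : T.q σ ∈ B := by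
      by_contra h
      exact hφσ (hφB' _ h)
    refine ⟨(ζ σ, T.q σ), ⟨trivial, subset_tsupport _ hφσ⟩, ?_⟩
    change T.act (ζ σ) (t (𝒢.r (T.q σ))) = σ
    rw [T.r_q]
    exact (hζ σ hσB).symm
  · intro z σ
    rw [T.q_act]
    by_cases hσ : T.q σ ∈ B
    · have e : ζ (T.act z σ) = z * ζ σ := by
        have h1 := hζ (T.act z σ) (by rwa [T.q_act])
        rw [T.r_act] at h1
        refine T.act_left_injective (σ := t (T.grpd.r σ)) ?_
        rw [← h1, ← act_act, ← hζ σ hσ]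
      rw [e, Circle.coe_mul, mul_assoc]
    · rw [hφB' _ hσ, Complex.ofReal_zero, mul_zero, mul_zero, mul_zero]
  · intro σ hσ
    have e : φ (T.q σ) = 1 := by rw [hσ]; exact hφα rfl
    change (ζ σ : ℂ) * φ (T.q σ) ≠ 0
    rw [e]
    simp
  · intro σ hσ hr
    have hσB : T.q σ ∈ B := by
      by_contra h
      refine hσ ?_
      change (ζ σ : ℂ) * φ (T.q σ) = 0
      rw [hφB' _ h, Complex.ofReal_zero, mul_zero]
    rw [← hqt _ hσB, T.r_q, hr, hqt _ hαB]

/-! ### Fibre supports -/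

/-- The absolute values of the entries of an element of `C*_r(Σ; G)` come from a continuous
function on `G`. -/
theorem Section.exists_norm_entry [T2Space G] (c : T.Section)
    {a : HilbertL2 G →L[ℂ] HilbertL2 G} (ha : a ∈ c.reducedAlgebra) :
    ∃ F : G → ℝ, Continuous F ∧ ∀ γ η (h : 𝒢.s γ = 𝒢.s η),
      ‖HilbertL2.entry a γ η‖ = F (𝒢.mul γ (𝒢.inv η) (h.trans (𝒢.r_inv η).symm)) := by
  obtain ⟨k, hk⟩ := c.exists_isKernel ha
  have hq : ∀ σ τ, T.q σ = T.q τ → ‖k σ‖ = ‖k τ‖ := fun σ τ h => by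
    obtain ⟨z, rfl⟩ := T.exists_eq_act h
    rw [hk.map_act, norm_mul, Circle.norm_coe, one_mul]
  refine ⟨fun γ => ‖k (c γ)‖, continuous_iff_continuousAt.2 fun γ => ?_, fun γ η h => ?_⟩
  · obtain ⟨B, hB, hγ, S, hS, hqS⟩ := T.exists_local_section γ
    refine ContinuousOn.continuousAt ?_ (hB.mem_nhds hγ)
    rw [continuousOn_iff_continuous_domRestrict]
    exact (hk.continuous.comp hS).norm.congr fun b => hq _ _ ((hqS b).trans (c.q_toFun _).symm)
  · rw [hk.entry_eq γ η h]
    exact hq _ _ ((c.q_mul_inv h).trans (c.q_toFun _).symm)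

theorem Section.entry_eq_zero [T2Space G] (c : T.Section)
    {a : HilbertL2 G →L[ℂ] HilbertL2 G} (ha : a ∈ c.reducedAlgebra) {γ η : G}
    (h : 𝒢.s γ ≠ 𝒢.s η) : HilbertL2.entry a γ η = 0 :=
  (c.exists_isKernel ha).choose_spec.entry_eq_zero γ η h

/-- The set of units `x` at which the restriction of `a` to `ℓ²(G_x)` is nonzero. -/
def fiberSupport (𝒢 : EtaleGroupoid X G) (a : HilbertL2 G →L[ℂ] HilbertL2 G) : Set X :=
  {x | ∃ γ η, 𝒢.s γ = x ∧ 𝒢.s η = x ∧ HilbertL2.entry a γ η ≠ 0}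

theorem Section.isOpen_fiberSupport [T2Space G] (c : T.Section)
    {a : HilbertL2 G →L[ℂ] HilbertL2 G} (ha : a ∈ c.reducedAlgebra) :
    IsOpen (fiberSupport 𝒢 a) := by
  obtain ⟨F, hF, hFa⟩ := c.exists_norm_entry ha
  have e : fiberSupport 𝒢 a = 𝒢.s '' (𝒢.r ⁻¹' (𝒢.s '' (F ⁻¹' {0}ᶜ))) := by
    ext x
    constructor
    · rintro ⟨γ, η, hγ, rfl, hne⟩
      refine ⟨η, ⟨𝒢.mul γ (𝒢.inv η) (hγ.trans (𝒢.r_inv η).symm), ?_, ?_⟩, rfl⟩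
      · rw [Set.mem_preimage, ← hFa γ η hγ]
        exact norm_ne_zero_iff.2 hne
      · rw [𝒢.s_mul, 𝒢.s_inv]
    · rintro ⟨η, ⟨α, hα, hαη⟩, rfl⟩
      refine ⟨𝒢.mul α η hαη, η, 𝒢.s_mul _ _ _, rfl, fun h0 => hα ?_⟩
      have := hFa _ _ (𝒢.s_mul α η hαη)
      rw [h0, norm_zero, TopGroupoid.mul_inv_cancel] at this
      exact this.symm
  rw [e]
  have hs := 𝒢.isLocalHomeomorph_s.isOpenMap
  exact hs _ ((hs _ (isOpen_compl_singleton.preimage hF)).preimage 𝒢.continuous_r)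

/-- Right translation by `β` identifies the fibres over `r(β)` and `s(β)`. -/
theorem Section.invariant_fiberSupport [T2Space G] (c : T.Section)
    {a : HilbertL2 G →L[ℂ] HilbertL2 G} (ha : a ∈ c.reducedAlgebra) :
    𝒢.Invariant (fiberSupport 𝒢 a) := by
  obtain ⟨F, -, hFa⟩ := c.exists_norm_entry ha
  rintro β ⟨γ, η, hγ, hη, hne⟩
  have H : ∀ {δ}, 𝒢.s δ = 𝒢.s β → 𝒢.s δ = 𝒢.r (𝒢.inv β) := fun h => h.trans (𝒢.r_inv β).symm
  have hs : ∀ {δ} (h : 𝒢.s δ = 𝒢.s β), 𝒢.s (𝒢.mul δ (𝒢.inv β) (H h)) = 𝒢.r β := fun h => by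
    rw [𝒢.s_mul, 𝒢.s_inv]
  refine ⟨𝒢.mul γ (𝒢.inv β) (H hγ), 𝒢.mul η (𝒢.inv β) (H hη), hs hγ, hs hη, fun h0 => hne ?_⟩
  rw [← norm_eq_zero] at h0 ⊢
  rw [hFa _ _ ((hs hγ).trans (hs hη).symm)] at h0
  rw [hFa _ _ (hγ.trans hη.symm), ← h0]
  congr 1
  have e1 := TopGroupoid.mul_inv_cancel (𝒢 := 𝒢.toTopGroupoid) γ (𝒢.inv β) (H hγ)
  refine (TopGroupoid.mul_congr e1.symm rfl
    (hγ.trans (hη.symm.trans (𝒢.r_inv η).symm))).trans ?_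
  rw [𝒢.mul_assoc _ _ _ (((𝒢.s_mul _ _ _)).trans (𝒢.r_inv _).symm)
    ((𝒢.s_inv _).trans ((𝒢.r_inv β).trans (hη.symm.trans (𝒢.r_inv η).symm)))]
  exact TopGroupoid.mul_congr rfl (TopGroupoid.inv_mul_rev _ _ _).symm _

theorem Section.fiberSupport_mul_subset [T2Space G] (c : T.Section)
    {a : HilbertL2 G →L[ℂ] HilbertL2 G} (ha : a ∈ c.reducedAlgebra)
    (b : HilbertL2 G →L[ℂ] HilbertL2 G) :
    fiberSupport 𝒢 (a * b) ⊆ fiberSupport 𝒢 a ∩ fiberSupport 𝒢 b := by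
  rintro x ⟨γ, η, hγ, hη, hne⟩
  rw [HilbertL2.entry_mul] at hne
  obtain ⟨ζ, hζ⟩ : ∃ ζ, HilbertL2.entry a γ ζ * HilbertL2.entry b ζ η ≠ 0 := by
    by_contra! h
    exact hne ((tsum_congr h).trans tsum_zero)
  have ha0 := left_ne_zero_of_mul hζ
  have hs : 𝒢.s γ = 𝒢.s ζ := by
    by_contra h
    exact ha0 (c.entry_eq_zero ha h)
  exact ⟨⟨γ, ζ, hγ, hs ▸ hγ, ha0⟩, ⟨ζ, η, hs ▸ hγ, hη, right_ne_zero_of_mul hζ⟩⟩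

theorem Section.eq_zero_of_fiberSupport_eq_empty [T2Space G] (c : T.Section)
    {a : HilbertL2 G →L[ℂ] HilbertL2 G} (ha : a ∈ c.reducedAlgebra)
    (h : fiberSupport 𝒢 a = ∅) : a = 0 := by
  refine HilbertL2.ext_entry fun γ η => ?_
  rw [HilbertL2.entry_zero]
  by_contra hne
  have hs : 𝒢.s γ = 𝒢.s η := by
    by_contra hs
    exact hne (c.entry_eq_zero ha hs)
  exact (h ▸ (⟨γ, η, hs, rfl, hne⟩ : 𝒢.s η ∈ fiberSupport 𝒢 a) : 𝒢.s η ∈ (∅ : Set X))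

/-! ### Ideals over invariant open sets -/

open scoped ZeroAtInfty

theorem entry_unitOp_mul (h : C₀(X, ℂ)) (a : HilbertL2 G →L[ℂ] HilbertL2 G) (γ η : G) :
    HilbertL2.entry (unitOp 𝒢 h * a) γ η = h (𝒢.r γ) * HilbertL2.entry a γ η :=
  unitOp_apply h _ γ

open Classical in
theorem entry_unitOp (h : C₀(X, ℂ)) (γ η : G) :
    HilbertL2.entry (unitOp 𝒢 h) γ η = if γ = η then h (𝒢.r γ) else 0 := by
  rw [HilbertL2.entry_def, unitOp_apply, lp.single_apply, Pi.single_apply]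
  split_ifs <;> simp

/-- For invariant `U`, exactness identifies the image of `C*_r(Σ_U; G_U)` with the ideal of
elements that vanish on all fibres outside `U`. -/
theorem Section.mem_openSubalgebra_iff [T2Space G] [T2Space E] (c : T.Section)
    (hexact : c.InnerExact) {U : Set X} (hU : 𝒢.Invariant U) (hop : IsOpen U)
    (a : c.reducedAlgebra) :
    a ∈ c.openSubalgebra U hU hop ↔ fiberSupport 𝒢 (a : HilbertL2 G →L[ℂ] HilbertL2 G) ⊆ U := by
  refine (hexact U hU hop a).symm.trans ?_
  constructor
  · rintro h x ⟨γ, η, hγ, rfl, hne⟩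
    by_contra hx
    have hη : η ∈ 𝒢.reduction Uᶜ := (hU.compl.mem_reduction_iff η).2 hx
    have hγ' : γ ∈ 𝒢.reduction Uᶜ := (hU.compl.mem_reduction_iff γ).2 (by rwa [hγ])
    refine hne ?_
    have e : HilbertL2.compress (𝒢.reduction Uᶜ) (a : HilbertL2 G →L[ℂ] HilbertL2 G) = 0 :=
      congrArg Subtype.val h
    rw [← HilbertL2.entry_compress (𝒢.reduction Uᶜ) _ ⟨γ, hγ'⟩ ⟨η, hη⟩, e, HilbertL2.entry_zero]
  · intro h
    refine Subtype.ext (HilbertL2.ext_entry fun γ η => ?_)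
    change HilbertL2.entry (HilbertL2.compress (𝒢.reduction Uᶜ) a.1) γ η = 0
    rw [HilbertL2.entry_compress]
    by_contra hne
    refine η.2.2 (h ⟨γ, η, ?_, rfl, hne⟩)
    by_contra hs
    exact hne (c.entry_eq_zero a.2 hs)

/-- The annihilator of the ideal of elements supported over `U` consists of the elements supported
over the exterior of `U`. That it is no larger rests on the openness of fibre supports. -/
theorem Section.perp_setOf_fiberSupport_subset [T2Space G] [LocallyCompactSpace G] [T2Space E]
    (c : T.Section) {U : Set X} (hU : 𝒢.Invariant U) (hop : IsOpen U) :
    perp {a : c.reducedAlgebra | fiberSupport 𝒢 a.1 ⊆ U} =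
      {a : c.reducedAlgebra | fiberSupport 𝒢 a.1 ⊆ interior Uᶜ} := by
  classical
  have : T2Space X := (isOpenEmbedding_unit 𝒢).isEmbedding.t2Space
  have : LocallyCompactSpace X := (isOpenEmbedding_unit 𝒢).locallyCompactSpace
  ext a
  constructor
  · intro ha
    refine interior_maximal (fun x hx hxU => ?_) (c.isOpen_fiberSupport a.2)
    obtain ⟨γ, η, hγ, hη, hne⟩ := hx
    have hr : 𝒢.r γ ∈ U := hU γ (by rwa [hγ])
    obtain ⟨φ, hφ1, hφ0, hφc, -⟩ := exists_continuous_one_zero_of_isCompact (isCompact_singleton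
      (x := 𝒢.r γ)) hop.isClosed_compl
      (Set.disjoint_left.2 fun y hy hy' => hy' (by rw [hy]; exact hr))
    let h : C₀(X, ℂ) :=
      { toFun := fun x => (φ x : ℂ)
        continuous_toFun := Complex.continuous_ofReal.comp φ.continuous
        zero_at_infty' := (hφc.comp_left Complex.ofReal_zero).is_zero_at_infty }
    have hmem : fiberSupport 𝒢 (unitOp 𝒢 h) ⊆ U := by
      rintro y ⟨α, β, rfl, -, hαβ⟩
      by_contra hy
      refine hαβ ?_
      rw [entry_unitOp]
      split_ifs with e
      · have : φ (𝒢.r α) = 0 := hφ0 fun hr' => hy ((hU.range_mem_iff α).1 hr')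
        change ((φ (𝒢.r α) : ℝ) : ℂ) = 0
        rw [this, Complex.ofReal_zero]
      · rfl
    have h0 := congrArg Subtype.val (ha (c.unitHom h) hmem).2
    have e : HilbertL2.entry (unitOp 𝒢 h * a.1) γ η = 0 := by
      rw [show unitOp 𝒢 h * a.1 = 0 from h0, HilbertL2.entry_zero]
    rw [entry_unitOp_mul] at e
    have e1 : h (𝒢.r γ) = 1 := by
      change ((φ (𝒢.r γ) : ℝ) : ℂ) = 1
      rw [hφ1 rfl, Pi.one_apply, Complex.ofReal_one]
    rw [e1, one_mul] at e
    exact hne e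
  · intro ha b hb
    have hdisj : ∀ x ∈ fiberSupport 𝒢 a.1, x ∉ fiberSupport 𝒢 b.1 :=
      fun x hx hx' => interior_subset (ha hx) (hb hx')
    refine ⟨Subtype.ext (c.eq_zero_of_fiberSupport_eq_empty (a * b).2 ?_),
      Subtype.ext (c.eq_zero_of_fiberSupport_eq_empty (b * a).2 ?_)⟩
    · refine Set.eq_empty_of_forall_notMem fun x hx => ?_
      have hx' := c.fiberSupport_mul_subset a.2 b.1 hx
      exact hdisj x hx'.1 hx'.2
    · refine Set.eq_empty_of_forall_notMem fun x hx => ?_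
      have hx' := c.fiberSupport_mul_subset b.2 a.1 hx
      exact hdisj x hx'.2 hx'.1

end Twist

theorem EtaleGroupoid.invariant_interior {X G : Type*} [TopologicalSpace X] [TopologicalSpace G]
    {𝒢 : EtaleGroupoid X G} {S : Set X} (hS : 𝒢.Invariant S) : 𝒢.Invariant (interior S) := by
  intro γ hγ
  have hsub : 𝒢.r '' (𝒢.s ⁻¹' interior S) ⊆ S := by
    rintro _ ⟨β, hβ, rfl⟩
    exact hS β (interior_subset hβ)
  exact interior_maximal hsub (𝒢.isLocalHomeomorph_r.isOpenMap _
    (isOpen_interior.preimage 𝒢.continuous_s)) ⟨γ, hγ, rfl⟩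

/-! ### Annihilators -/

section RegularIdeals

variable {A : Type*} [NonUnitalRing A]

theorem subset_perp_perp (S : Set A) : S ⊆ perp (perp S) :=
  fun x hx _ ha => ⟨(ha x hx).2, (ha x hx).1⟩

theorem perp_anti {S S' : Set A} (h : S ⊆ S') : perp S' ⊆ perp S :=
  fun _ ha x hx => ha x (h hx)

theorem perp_perp_perp (S : Set A) : perp (perp (perp S)) = perp S :=
  (perp_anti (subset_perp_perp S)).antisymm (subset_perp_perp _)

theorem mul_mem_perp {S : Set A} (hS : ∀ a, ∀ x ∈ S, a * x ∈ S ∧ x * a ∈ S) (a : A) {y : A}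
    (hy : y ∈ perp S) : a * y ∈ perp S ∧ y * a ∈ perp S := by
  refine ⟨fun x hx => ⟨?_, ?_⟩, fun x hx => ⟨?_, ?_⟩⟩
  · rw [mul_assoc, (hy x hx).1, mul_zero]
  · rw [← mul_assoc, (hy _ (hS a x hx).2).2]
  · rw [mul_assoc, (hy _ (hS a x hx).1).1]
  · rw [← mul_assoc, (hy x hx).2, zero_mul]

variable [Module ℂ A]

/-- The annihilator `S^⊥` as a linear subspace. -/
def perpSubmodule [IsScalarTower ℂ A A] [SMulCommClass ℂ A A] (S : Set A) : Submodule ℂ A where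
  carrier := perp S
  zero_mem' x _ := ⟨zero_mul x, mul_zero x⟩
  add_mem' ha hb x hx := ⟨by rw [add_mul, (ha x hx).1, (hb x hx).1, add_zero],
    by rw [mul_add, (ha x hx).2, (hb x hx).2, add_zero]⟩
  smul_mem' z _ ha x hx := ⟨by rw [smul_mul_assoc, (ha x hx).1, smul_zero],
    by rw [mul_smul_comm, (ha x hx).2, smul_zero]⟩

theorem isRegularIdeal_perpSubmodule [TopologicalSpace A] [T2Space A] [ContinuousMul A]
    [IsScalarTower ℂ A A] [SMulCommClass ℂ A A] {S : Set A}
    (hS : ∀ a, ∀ x ∈ S, a * x ∈ S ∧ x * a ∈ S) : IsRegularIdeal (perpSubmodule S) := by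
  refine ⟨⟨?_, fun _ _ hx => mul_mem_perp hS _ hx⟩, (perp_perp_perp S).symm⟩
  have e : perp S = ⋂ x ∈ S, {a | a * x = 0} ∩ {a | x * a = 0} := by
    ext a
    simp [perp]
  change IsClosed (perp S)
  rw [e]
  exact isClosed_biInter fun x _ => (isClosed_eq (by fun_prop) continuous_const).inter
    (isClosed_eq (by fun_prop) continuous_const)

end RegularIdeals

/-! ### Regular ideals of the reduced algebra -/

namespace Twist

variable {X G E : Type*} [TopologicalSpace X] [TopologicalSpace G] [TopologicalSpace E]
  {𝒢 : EtaleGroupoid X G} {T : Twist 𝒢 E}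

theorem Section.isClosedIdeal_openSubalgebra [T2Space G] [T2Space E] (c : T.Section)
    (hexact : c.InnerExact) {U : Set X} (hU : 𝒢.Invariant U) (hop : IsOpen U) :
    IsClosedIdeal (c.openSubalgebra U hU hop).toSubmodule := by
  have hmem := c.mem_openSubalgebra_iff hexact hU hop
  refine ⟨?_, fun a x hx => ⟨(hmem _).2 ?_, (hmem _).2 ?_⟩⟩
  · have e : ((c.openSubalgebra U hU hop).toSubmodule : Set c.reducedAlgebra) =
        ⋂ γ, ⋂ η, ⋂ _ : 𝒢.s γ = 𝒢.s η, ⋂ _ : 𝒢.s η ∉ U,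
          {a : c.reducedAlgebra | HilbertL2.entry a.1 γ η = 0} := by
      ext a
      refine (hmem a).trans ?_
      simp only [Set.mem_iInter, Set.mem_ofPred_eq]
      constructor
      · intro h γ η hs hη
        by_contra hne
        exact hη (h ⟨γ, η, hs, rfl, hne⟩)
      · rintro h x ⟨γ, η, hγ, rfl, hne⟩
        by_contra hx
        exact hne (h γ η hγ hx)
    rw [e]
    exact isClosed_iInter fun γ => isClosed_iInter fun η => isClosed_iInter fun _ =>
      isClosed_iInter fun _ => isClosed_eq
        ((HilbertL2.continuous_entry γ η).comp continuous_subtype_val) continuous_const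
  · exact (c.fiberSupport_mul_subset a.2 x.1).trans
      (Set.inter_subset_right.trans ((hmem x).1 hx))
  · exact (c.fiberSupport_mul_subset x.2 a.1).trans
      (Set.inter_subset_left.trans ((hmem x).1 hx))

theorem Section.isRegularIdeal_openSubalgebra [T2Space G] [LocallyCompactSpace G] [T2Space E]
    (c : T.Section) (hexact : c.InnerExact) {U : Set X} (hU : 𝒢.Invariant U)
    (hreg : IsRegularOpen U) :
    IsRegularIdeal (c.openSubalgebra U hU hreg.isOpen).toSubmodule := by
  refine ⟨c.isClosedIdeal_openSubalgebra hexact hU hreg.isOpen, ?_⟩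
  have e : ((c.openSubalgebra U hU hreg.isOpen).toSubmodule : Set c.reducedAlgebra) =
      {a : c.reducedAlgebra | fiberSupport 𝒢 a.1 ⊆ U} :=
    Set.ext (c.mem_openSubalgebra_iff hexact hU hreg.isOpen)
  have hUU : interior (interior Uᶜ)ᶜ = U := by
    rw [show (interior Uᶜ)ᶜ = closure U by rw [interior_compl, compl_compl]]
    exact hreg
  rw [e, c.perp_setOf_fiberSupport_subset hU hreg.isOpen,
    c.perp_setOf_fiberSupport_subset (EtaleGroupoid.invariant_interior hU.compl) isOpen_interior,
    hUU]

/-- Left multiplication by a function supported on a slice moves a nonzero entry of `a` in the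
fibre over `y` into the row of the unit `y`. -/
theorem Section.exists_entry_leftRegular_mul_ne_zero [T2Space G] [LocallyCompactSpace G]
    [T2Space E] (c : T.Section) (a : HilbertL2 G →L[ℂ] HilbertL2 G) {γ η : G}
    (hne : HilbertL2.entry a γ η ≠ 0) :
    ∃ f : T.Cc, HilbertL2.entry (c.leftRegular f * a) (𝒢.unit (𝒢.s γ)) η ≠ 0 := by
  obtain ⟨f, hf, hf'⟩ := T.exists_cc_slice (𝒢.inv γ)
  have hu : ∀ ζ (h : 𝒢.s (𝒢.unit (𝒢.s γ)) = 𝒢.s ζ),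
      T.q (T.grpd.mul (c (𝒢.unit (𝒢.s γ))) (T.grpd.inv (c ζ)) (c.composable h)) = 𝒢.inv ζ := by
    intro ζ h
    rw [c.q_mul_inv h]
    have h' : 𝒢.s γ = 𝒢.r (𝒢.inv ζ) := by rw [𝒢.r_inv, ← h, 𝒢.s_unit]
    exact (TopGroupoid.mul_congr (congrArg 𝒢.unit h') rfl _).trans (𝒢.unit_mul _)
  refine ⟨f, ?_⟩
  rw [HilbertL2.entry_mul, tsum_eq_single γ]
  · refine mul_ne_zero ?_ hne
    rw [c.entry_leftRegular, matrix, dif_pos (𝒢.s_unit _)]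
    exact hf _ (hu γ (𝒢.s_unit _))
  · intro ζ hζ
    rw [c.entry_leftRegular, matrix]
    split_ifs with h
    · by_contra h0
      have h1 := hf' _ (left_ne_zero_of_mul h0)
        (by rw [T.grpd.r_mul, c.r_eq, 𝒢.r_unit, 𝒢.r_inv])
      rw [hu ζ h] at h1
      exact hζ (TopGroupoid.inv_injective h1)
    · rw [zero_mul]

/-- A regular ideal `J` is the ideal over the interior of the closure of the set of units where
some element of `J` is nonzero. -/
theorem Section.exists_eq_openSubalgebra [T2Space G] [LocallyCompactSpace G] [T2Space E]
    (c : T.Section) (hexact : c.InnerExact)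
    (hint : HasRegularIdealIntersectionProperty (Set.range c.unitHom))
    {J : Submodule ℂ c.reducedAlgebra} (hJ : IsRegularIdeal J) :
    ∃ (U : Set X) (hU : 𝒢.Invariant U) (hreg : IsRegularOpen U),
      J = (c.openSubalgebra U hU hreg.isOpen).toSubmodule := by
  classical
  set V : Set X := ⋃ a ∈ J, fiberSupport 𝒢 a.1
  have hVinv : 𝒢.Invariant V := fun γ hγ => by
    obtain ⟨a, ha, hγa⟩ := Set.mem_iUnion₂.1 hγ
    exact Set.mem_iUnion₂.2 ⟨a, ha, c.invariant_fiberSupport a.2 γ hγa⟩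
  have hVop : IsOpen V := isOpen_biUnion fun a _ => c.isOpen_fiberSupport a.2
  set W : Set X := interior (closure V)
  have hWinv : 𝒢.Invariant W := by
    refine EtaleGroupoid.invariant_interior ?_
    rw [← compl_compl (closure V), ← interior_compl]
    exact (EtaleGroupoid.invariant_interior hVinv.compl).compl
  have hWreg : IsRegularOpen W := interior_closure_idem
  set K := (c.openSubalgebra W hWinv hWreg.isOpen).toSubmodule
  have hK : IsRegularIdeal K := c.isRegularIdeal_openSubalgebra hexact hWinv hWreg
  have hKmem : ∀ a, a ∈ K ↔ fiberSupport 𝒢 a.1 ⊆ W :=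
    c.mem_openSubalgebra_iff hexact hWinv hWreg.isOpen
  -- `S^⊥ = J^⊥ ∩ K`
  set S : Set c.reducedAlgebra := J ∪ perp K
  have hS : ∀ a, ∀ x ∈ S, a * x ∈ S ∧ x * a ∈ S := by
    rintro a x (hx | hx)
    · exact ⟨Or.inl (hJ.1.2 a x hx).1, Or.inl (hJ.1.2 a x hx).2⟩
    · exact ⟨Or.inr (mul_mem_perp hK.1.2 a hx).1, Or.inr (mul_mem_perp hK.1.2 a hx).2⟩
  have hbot : perpSubmodule S = ⊥ := by
    by_contra hne
    obtain ⟨_, ⟨h, rfl⟩, hh, hh0⟩ := hint _ (isRegularIdeal_perpSubmodule hS) hne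
    obtain ⟨x, hx⟩ : ∃ x, h x ≠ 0 := by
      by_contra! h0
      have : h = 0 := ZeroAtInftyContinuousMap.ext h0
      exact hh0 (by rw [this, map_zero])
    have hhK : c.unitHom h ∈ K := by
      rw [← SetLike.mem_coe, hK.2]
      exact perp_anti Set.subset_union_right hh
    have hxW : x ∈ W := by
      refine (hKmem _).1 hhK ⟨𝒢.unit x, 𝒢.unit x, 𝒢.s_unit x, 𝒢.s_unit x, ?_⟩
      change HilbertL2.entry (unitOp 𝒢 h) _ _ ≠ 0
      rw [entry_unitOp, if_pos rfl, 𝒢.r_unit]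
      exact hx
    obtain ⟨y, hy, hyV⟩ := mem_closure_iff.1 (interior_subset hxW) (h ⁻¹' {0}ᶜ)
      (isOpen_compl_singleton.preimage h.continuous) hx
    obtain ⟨a, ha, γ, η, rfl, -, hne'⟩ := Set.mem_iUnion₂.1 hyV
    obtain ⟨f, hf⟩ := c.exists_entry_leftRegular_mul_ne_zero a.1 hne'
    have h0 := congrArg Subtype.val
      (hh _ (Or.inl (hJ.1.2 ⟨c.leftRegular f, c.leftRegular_mem f⟩ a ha).1)).1
    have h1 : HilbertL2.entry (unitOp 𝒢 h * (c.leftRegular f * a.1))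
        (𝒢.unit (𝒢.s γ)) η = 0 := by
      rw [show unitOp 𝒢 h * (c.leftRegular f * a.1) = 0 from h0, HilbertL2.entry_zero]
    rw [entry_unitOp_mul, 𝒢.r_unit] at h1
    exact (mul_ne_zero hy hf) h1
  refine ⟨W, hWinv, hWreg, le_antisymm (fun a ha => (hKmem a).2 ?_) fun a ha => ?_⟩
  · exact (Set.subset_biUnion_of_mem (u := fun a : c.reducedAlgebra => fiberSupport 𝒢 a.1)
      ha).trans (interior_maximal subset_closure hVop)
  · have hzero : ∀ d, d ∈ perp (J : Set c.reducedAlgebra) → d ∈ K → d = 0 := fun d hd hdK => by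
      have : d ∈ perpSubmodule S := by
        rintro x (hx | hx)
        · exact hd x hx
        · exact ⟨(hx d hdK).2, (hx d hdK).1⟩
      rwa [hbot, Submodule.mem_bot] at this
    rw [← SetLike.mem_coe, hJ.2]
    intro b hb
    exact ⟨hzero _ (mul_mem_perp hJ.1.2 a hb).1 (hK.1.2 b a ha).2,
      hzero _ (mul_mem_perp hJ.1.2 a hb).2 (hK.1.2 b a ha).1⟩

end Twist

theorem mainTheorem4 {X G E : Type*} [TopologicalSpace X] [TopologicalSpace G]
    [TopologicalSpace E] [T2Space G] [LocallyCompactSpace G] [T2Space E] [LocallyCompactSpace E]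
    (𝒢 : EtaleGroupoid X G) (T : Twist 𝒢 E) (c : T.Section) (hexact : c.InnerExact) :
    (∀ (U : Set X) (hU : 𝒢.Invariant U) (hreg : IsRegularOpen U),
      IsRegularIdeal (c.openSubalgebra U hU hreg.isOpen).toSubmodule) ∧
    (HasRegularIdealIntersectionProperty (Set.range c.unitHom) →
      ∀ J : Submodule ℂ c.reducedAlgebra, IsRegularIdeal J →
        ∃ (U : Set X) (hU : 𝒢.Invariant U) (hreg : IsRegularOpen U),
          J = (c.openSubalgebra U hU hreg.isOpen).toSubmodule) :=
  ⟨fun _ hU hreg => c.isRegularIdeal_openSubalgebra hexact hU hreg,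
    fun hint _ hJ => c.exists_eq_openSubalgebra hexact hint hJ⟩
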